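/- Let $L,T\ge 1$ and let $G$ be the $L$-by-$T$ grid: its vertices are $v_{l,t}$ ($1\le l\le L$, $1\le t\le T$) and its arcs are the downward arcs $(v_{l,t},v_{l+1,t})$ and the forward arcs $(v_{l,t},v_{l,t+1})$. An instance of the uncapacitated minimum-concave-cost flow problem on the grid (U-MFG) consists of supplies $b_v\in\mathbb Z$ with $\sum_v b_v=0$ and concave arc costs; every arc has infinite capacity. Its flow polyhedron $P_F$ is the set of all $x\in\mathbb R^A$ with $x\ge 0$ and $\sum_{a\in\delta^+(v)}x_a-\sum_{a\in\delta^-(v)}x_a=b_v$ for every vertex $v$, where $\delta^+(v)$ and $\delta^-(v)$ are the sets of arcs leaving and entering $v$. A source is a vertex $v$ with $b_v>0$. Time is measured on the real random access machine, in which each arithmetic operation, comparison or memory access takes one step. There are an absolute constant $C$ and one algorithm such that the following holds for all $L,T\ge 1$, every instance of the U-MFG on the $L$-by-$T$ grid all of whose sources lie in one row, and every arc $a$. (1) The set $\{f_a : f \text{ an extreme point of } P_F\}$ is finite and has at most $C\,T^{4L-2}$ elements. (2) Given $L$, $T$, the supplies $b$ and the arc $a$, the algorithm halts and outputs a finite list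 of real numbers in which every value $f_a$ at an extreme point $f$ of $P_F$ occurs. It takes at most $C\,T^{4L-2}$ steps if $T\ge 2$ (so the list has at most $C\,T^{4L-2}$ entries), and at most $C\,L$ steps if $T=1$. -/

import Mathlib

/-! ### The grid and the minimum-concave-cost flow problem -/

namespace GridFlow

/-- Vertices of the `L`-by-`T` grid: `(l, t)` is the vertex in row `l` and column `t`
(both counted from `0`). -/
abbrev Vertex (L T : ℕ) : Type := Fin L × Fin T

/-- `(u, v)` is a downward arc (next row, same column) or a forward arc (same row, next column). -/
def IsArc {L T : ℕ} (u v : Vertex L T) : Prop :=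
  (v.1.val = u.1.val + 1 ∧ v.2 = u.2) ∨ (v.1 = u.1 ∧ v.2.val = u.2.val + 1)

instance {L T : ℕ} (u v : Vertex L T) : Decidable (IsArc u v) := by
  unfold IsArc; infer_instance

/-- The arcs of the grid. -/
abbrev Arc (L T : ℕ) : Type := {e : Vertex L T × Vertex L T // IsArc e.1 e.2}

/-- The vertex an arc leaves. -/
def Arc.tail {L T : ℕ} (a : Arc L T) : Vertex L T := a.1.1

/-- The vertex an arc enters. -/
def Arc.head {L T : ℕ} (a : Arc L T) : Vertex L T := a.1.2

/-- An instance of the minimum-concave-cost flow problem on the `L`-by-`T` grid. -/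
structure MFG (L T : ℕ) where
  /-- the supply vector -/
  b : Vertex L T → ℤ
  /-- the arc capacities, `⊤` being an infinite capacity -/
  U : Arc L T → ℕ∞
  /-- the arc costs -/
  c : Arc L T → ℝ → ℝ
  net_supply : ∑ v, b v = 0
  concave : ∀ a, ConcaveOn ℝ (Set.Ici 0) (c a)

namespace MFG

variable {L T : ℕ}

/-- The flow polyhedron: flow conservation, nonnegativity and arc capacities. -/
def flowPolyhedron (I : MFG L T) : Set (Arc L T → ℝ) :=
  {x | (∀ v : Vertex L T,
          ∑ a with Arc.tail a = v, x a - ∑ a with Arc.head a = v, x a = (I.b v : ℝ)) ∧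
        ∀ a, 0 ≤ x a ∧ ∀ k : ℕ, I.U a = k → x a ≤ k}

/-- Every arc has infinite capacity. -/
def IsUncapacitated (I : MFG L T) : Prop := ∀ a, I.U a = ⊤

/-- All sources (vertices of positive supply) lie in one row. -/
def SourcesInOneRow (I : MFG L T) : Prop := ∃ r : Fin L, ∀ v : Vertex L T, 0 < I.b v → v.1 = r

/-- The values that the flow over the arc `a` takes in the extreme points of the flow
polyhedron. -/
def extremeFlowValues (I : MFG L T) (a : Arc L T) : Set ℝ :=
  (fun f : Arc L T → ℝ => f a) '' Set.extremePoints ℝ I.flowPolyhedron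

end MFG

/-! ### The real random access machine

A machine has index registers (natural numbers), real registers, a memory of natural numbers and
a memory of reals (both addressed by the contents of index registers), a read-only input array
of reals and a write-only output list.  Every elementary instruction and every evaluation of
a test counts as one step. -/

/-- A configuration of the machine. -/
structure State where
  ireg : ℕ → ℕ
  rreg : ℕ → ℝ
  imem : ℕ → ℕ
  rmem : ℕ → ℝ
  inp : ℕ → ℝ
  out : List ℝ

/-- Elementary instructions.  The arguments are register names; the first one is the target,
except in `istore` and `rstore`, where it is the index register that holds the target address. -/
inductive Instr where
  | skip
  | iconst (x k : ℕ)
  | imove (x y : ℕ)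
  | iadd (x y z : ℕ)
  | isub (x y z : ℕ)
  | imul (x y z : ℕ)
  | iload (x y : ℕ)
  | istore (x y : ℕ)
  | rconst (x : ℕ) (k : ℤ)
  | rmove (x y : ℕ)
  | radd (x y z : ℕ)
  | rsub (x y z : ℕ)
  | rmul (x y z : ℕ)
  | rdiv (x y z : ℕ)
  | rload (x y : ℕ)
  | rstore (x y : ℕ)
  | read (x y : ℕ)
  | emit (y : ℕ)

/-- The effect of an elementary instruction (`isub` is truncated at `0`, and dividing by `0`
gives `0`). -/
noncomputable def Instr.apply : Instr → State → State
  | .skip, s => s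
  | .iconst x k, s => { s with ireg := Function.update s.ireg x k }
  | .imove x y, s => { s with ireg := Function.update s.ireg x (s.ireg y) }
  | .iadd x y z, s => { s with ireg := Function.update s.ireg x (s.ireg y + s.ireg z) }
  | .isub x y z, s => { s with ireg := Function.update s.ireg x (s.ireg y - s.ireg z) }
  | .imul x y z, s => { s with ireg := Function.update s.ireg x (s.ireg y * s.ireg z) }
  | .iload x y, s => { s with ireg := Function.update s.ireg x (s.imem (s.ireg y)) }
  | .istore x y, s => { s with imem := Function.update s.imem (s.ireg x) (s.ireg y) }
  | .rconst x k, s => { s with rreg := Function.update s.rreg x (k : ℝ) }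
  | .rmove x y, s => { s with rreg := Function.update s.rreg x (s.rreg y) }
  | .radd x y z, s => { s with rreg := Function.update s.rreg x (s.rreg y + s.rreg z) }
  | .rsub x y z, s => { s with rreg := Function.update s.rreg x (s.rreg y - s.rreg z) }
  | .rmul x y z, s => { s with rreg := Function.update s.rreg x (s.rreg y * s.rreg z) }
  | .rdiv x y z, s => { s with rreg := Function.update s.rreg x (s.rreg y / s.rreg z) }
  | .rload x y, s => { s with rreg := Function.update s.rreg x (s.rmem (s.ireg y)) }
  | .rstore x y, s => { s with rmem := Function.update s.rmem (s.ireg x) (s.rreg y) }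
  | .read x y, s => { s with rreg := Function.update s.rreg x (s.inp (s.ireg y)) }
  | .emit y, s => { s with out := s.out ++ [s.rreg y] }

/-- Tests: comparisons of two index registers or of two real registers. -/
inductive Cond where
  | ilt (x y : ℕ)
  | ile (x y : ℕ)
  | ieq (x y : ℕ)
  | rlt (x y : ℕ)
  | rle (x y : ℕ)
  | req (x y : ℕ)

/-- The truth value of a test. -/
def Cond.holds : Cond → State → Prop
  | .ilt x y, s => s.ireg x < s.ireg y
  | .ile x y, s => s.ireg x ≤ s.ireg y
  | .ieq x y, s => s.ireg x = s.ireg y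
  | .rlt x y, s => s.rreg x < s.rreg y
  | .rle x y, s => s.rreg x ≤ s.rreg y
  | .req x y, s => s.rreg x = s.rreg y

/-- Programs. -/
inductive Program where
  | instr (i : Instr)
  | seq (p q : Program)
  | cond (c : Cond) (p q : Program)
  | loop (c : Cond) (p : Program)

/-- `Runs p s s' n`: started in the configuration `s`, the program `p` halts in the
configuration `s'` after exactly `n` steps.  `loop c p` repeats `p` as long as `c` holds. -/
inductive Runs : Program → State → State → ℕ → Prop where
  | instr (i : Instr) (s : State) : Runs (.instr i) s (i.apply s) 1
  | seq {p q : Program} {s s' s'' : State} {m n : ℕ} :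
      Runs p s s' m → Runs q s' s'' n → Runs (.seq p q) s s'' (m + n)
  | cond_true {c : Cond} {p q : Program} {s s' : State} {n : ℕ} :
      c.holds s → Runs p s s' n → Runs (.cond c p q) s s' (n + 1)
  | cond_false {c : Cond} {p q : Program} {s s' : State} {n : ℕ} :
      ¬ c.holds s → Runs q s s' n → Runs (.cond c p q) s s' (n + 1)
  | loop_true {c : Cond} {p : Program} {s s' s'' : State} {m n : ℕ} :
      c.holds s → Runs p s s' m → Runs (.loop c p) s' s'' n → Runs (.loop c p) s s'' (m + n + 1)
  | loop_false {c : Cond} {p : Program} {s : State} :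
      ¬ c.holds s → Runs (.loop c p) s s 1

/-- The start configuration for the instance `I` and the arc `a`: index registers `0, …, 5` hold
`L`, `T`, the row and column of the tail of `a`, and the row and column of its head; the input
array holds the supplies row by row, the supply of `(l, t)` being at address `t + T * l`.
Everything else is `0`, and nothing has been output. -/
noncomputable def MFG.start {L T : ℕ} (I : MFG L T) (a : Arc L T) : State where
  ireg
    | 0 => L
    | 1 => T
    | 2 => a.tail.1
    | 3 => a.tail.2
    | 4 => a.head.1
    | 5 => a.head.2
    | _ => 0
  rreg _ := 0
  imem _ := 0
  rmem _ := 0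
  inp k := if h : k < L * T then (I.b (finProdFinEquiv.symm ⟨k, h⟩) : ℝ) else 0
  out := []

end GridFlow

/-! Fix an extreme point f and an arc a = (u, v) with f_a > 0. The support of f carries no nonzero
circulation, so once a is deleted from the support, u and v lie in different components
(`not_eqvGen_of_extreme`). If W is a union of components containing exactly one of u and v, then a
is the only arc with flow across the boundary of W, and f_a is, up to sign, the total supply of W
(`sum_supply_eq`). The point is to choose W so that its traces on the rows have few possible shapes.

Let r be the source row. Tracing flow upstream, every vertex with nonzero supply or on an arc with
flow is reached from row r along the support, and after deleting a it is still reached from row r or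
from v. All arcs go down or forward, so planarity gives two facts: paths joining the same two rows
in opposite orders meet (`crossing`), and paths from two vertices of row r to a common vertex
enclose a region that separates the other components meeting row r (`trapped`). Hence the component
of u cuts row r into gaps, and every other component stays in one gap if the two outer gaps are
identified. The gap belonging to v is an interval or the complement of one. From it,
`exists_separating` builds a W that meets row r in one interval and every later row, as far as
supplies are concerned, in a union or difference of two intervals, hence in two disjoint intervals.

For T ≥ 2 a row has 1 + T(T+1)/2 ≤ T² intervals, the empty one included. This leaves at most T² ·
(T⁴)^(L-1) = T^(4L-2) sums, up to sign. The algorithm lists them: it starts with the entry 0, makes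
one round of adding interval sums for row r, and two for each later row. Extending an interval by
one column is a single addition, so a new entry costs constantly many steps, and the costs of the
rounds grow geometrically. The bound on the number of values follows from the length of the output.
For T = 1 the estimate of the number of intervals fails, but there the grid is a path and the flow
over an arc is a prefix sum of the supplies. -/

namespace GridFlow

open Relation

/-! ### Directed paths in the grid -/

/-- Every step of the relation `A` goes one row down or one column forward. -/
def IsGridRel (A : ℕ × ℕ → ℕ × ℕ → Prop) : Prop :=
  ∀ p q, A p q → q = (p.1 + 1, p.2) ∨ q = (p.1, p.2 + 1)

variable {A : ℕ × ℕ → ℕ × ℕ → Prop}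

theorem eqvGen_of_reflTransGen {p q : ℕ × ℕ} (h : ReflTransGen A p q) : EqvGen A p q := by
  induction h with
  | refl => exact .refl _
  | tail _ h ih => exact ih.trans _ _ _ (.rel _ _ h)

theorem eqvGen_of_common {p q z : ℕ × ℕ} (hp : ReflTransGen A p z) (hq : ReflTransGen A q z) :
    EqvGen A p q :=
  (eqvGen_of_reflTransGen hp).trans _ _ _ ((eqvGen_of_reflTransGen hq).symm _ _)

namespace IsGridRel

theorem le (hA : IsGridRel A) {p q : ℕ × ℕ} (h : ReflTransGen A p q) :
    p.1 ≤ q.1 ∧ p.2 ≤ q.2 := by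
  induction h with
  | refl => exact ⟨le_rfl, le_rfl⟩
  | tail _ h ih => rcases hA _ _ h with h | h <;> simp [h] <;> omega

theorem exists_down (hA : IsGridRel A) {p q : ℕ × ℕ} (h : ReflTransGen A p q) {m : ℕ}
    (hp : p.1 ≤ m) (hq : m < q.1) :
    ∃ c, ReflTransGen A p (m, c) ∧ A (m, c) (m + 1, c) ∧ ReflTransGen A (m + 1, c) q := by
  induction h with
  | refl => omega
  | @tail q' q h1 h ih =>
    by_cases hm : m < q'.1
    · obtain ⟨c, h2, h3, h4⟩ := ih hm
      exact ⟨c, h2, h3, h4.tail h⟩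
    · rcases hA _ _ h with e | e
      · have : q' = (m, q'.2) := Prod.ext (by simp [e] at hq; simp; omega) rfl
        have h5 : q = (m + 1, q'.2) := by rw [e, this]
        exact ⟨q'.2, this ▸ h1, by rw [← this, ← h5]; exact h, by rw [h5]⟩
      · simp [e] at hq; omega

theorem exists_row (hA : IsGridRel A) {p q : ℕ × ℕ} (h : ReflTransGen A p q) {m : ℕ}
    (hp : p.1 ≤ m) (hq : m ≤ q.1) :
    ∃ c, ReflTransGen A p (m, c) ∧ ReflTransGen A (m, c) q := by
  rcases hq.lt_or_eq with hq | rfl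
  · obtain ⟨c, h1, h2, h3⟩ := hA.exists_down h hp hq
    exact ⟨c, h1, h3.head h2⟩
  · exact ⟨q.2, h, .refl⟩

/-- A directed path inside one row cannot skip a column. -/
theorem horizontal (hA : IsGridRel A) {m i j : ℕ} (h : ReflTransGen A (m, i) (m, j)) {c : ℕ}
    (hi : i ≤ c) (hj : c ≤ j) :
    ReflTransGen A (m, i) (m, c) ∧ ReflTransGen A (m, c) (m, j) := by
  suffices H : ∀ q, ReflTransGen A (m, i) q → q.1 = m → c ≤ q.2 →
      ReflTransGen A (m, i) (m, c) ∧ ReflTransGen A (m, c) q from H _ h rfl hj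
  intro q hq
  induction hq with
  | refl => intro _ h2; obtain rfl : c = i := le_antisymm h2 hi; exact ⟨.refl, .refl⟩
  | @tail q' q h1 h ih =>
    intro h2 h3
    have hle := hA.le h1
    rcases hA _ _ h with e | e
    · simp [e] at h2 hle; omega
    · by_cases hc : c ≤ q'.2
      · have := ih (by rw [← h2, e]) hc
        exact ⟨this.1, this.2.tail h⟩
      · have : q = (m, c) := Prod.ext h2 (by simp [e] at h3 ⊢; omega)
        exact ⟨this ▸ h1.tail h, this ▸ .refl⟩

/-- Two directed paths that start in one row and end in one row, in opposite orders, meet. -/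
theorem crossing (hA : IsGridRel A) {k i i' l c c' : ℕ} (h : ReflTransGen A (k, i) (l, c))
    (h' : ReflTransGen A (k, i') (l, c')) (hi : i ≤ i') (hc : c' ≤ c) :
    EqvGen A (k, i) (k, i') := by
  by_contra hcon
  -- If the components differ, everything reached from `i` lies strictly to the left of everything
  -- in the same row reached from `i'`: a step can close the distance only by landing on a common
  -- vertex.
  have key : ∀ w, ReflTransGen A (k, i) w → ∀ q, ReflTransGen A (k, i') (w.1, q) → w.2 < q := by
    intro w hw
    induction hw with
    | refl =>
      intro q hq
      have h1 := (hA.le hq).2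
      rcases (hi.trans h1).lt_or_eq with h2 | h2
      · exact h2
      · exact absurd (eqvGen_of_common .refl (by rw [h2]; exact hq)) hcon
    | @tail w' w h1 h2 ih =>
      intro q hq
      rcases hA _ _ h2 with e | e
      · subst e
        obtain ⟨p, h3, _, h5⟩ := hA.exists_down (m := w'.1) hq (hA.le h1).1 (by simp)
        exact (ih p h3).trans_le (hA.le h5).2
      · subst e
        rcases (Nat.succ_le_of_lt (ih q hq)).lt_or_eq with h3 | h3
        · exact h3
        · exact absurd (eqvGen_of_common (h1.tail h2) (by simpa [← h3] using hq)) hcon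
  exact absurd (key _ h _ h') (by simpa using hc)

/-- `w` lies strictly between the paths from `x` to `z` and those from `x'` to `z`. -/
def Between (A : ℕ × ℕ → ℕ × ℕ → Prop) (x x' z w : ℕ × ℕ) : Prop :=
  w.1 ≤ z.1 ∧ (∀ q, ReflTransGen A x (w.1, q) → ReflTransGen A (w.1, q) z → q < w.2) ∧
    (∀ q, ReflTransGen A x' (w.1, q) → ReflTransGen A (w.1, q) z → w.2 < q)

/-- The region is bounded by paths, and a single step can pass such a path only by landing on it,
which would put `w` into the component of `(r, i)`. -/
theorem between_iff_of_step (hA : IsGridRel A) {r i i' : ℕ} {z w w' : ℕ × ℕ}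
    (hz : ReflTransGen A (r, i) z) (hz' : ReflTransGen A (r, i') z) (hrow : r ≤ w.1)
    (hw : A w w') (hn : ¬ EqvGen A (r, i) w) :
    Between A (r, i) (r, i') z w ↔ Between A (r, i) (r, i') z w' := by
  have hii : EqvGen A (r, i) (r, i') := eqvGen_of_common hz hz'
  have hn1 : ¬ ReflTransGen A (r, i) w := fun h => hn (eqvGen_of_reflTransGen h)
  have hn2 : ¬ ReflTransGen A (r, i') w := fun h =>
    hn (hii.trans _ _ _ (eqvGen_of_reflTransGen h))
  have hn' : ¬ EqvGen A (r, i) w' := fun h =>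
    hn (h.trans _ _ _ ((EqvGen.rel _ _ hw).symm _ _))
  have hn1' : ¬ ReflTransGen A (r, i) w' := fun h => hn' (eqvGen_of_reflTransGen h)
  have hn2' : ¬ ReflTransGen A (r, i') w' := fun h =>
    hn' (hii.trans _ _ _ (eqvGen_of_reflTransGen h))
  obtain ⟨m, c⟩ := w
  rcases hA _ _ hw with e | e
  · subst e
    simp only at *
    constructor
    · rintro ⟨h1, h2, h3⟩
      simp only at h1 h2 h3
      -- In the row of `z` the vertex `z` ends both kinds of paths, so `w` would have to lie on both
      -- sides of it.
      have hm : m < z.1 := by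
        rcases h1.lt_or_eq with h | h
        · exact h
        · have e : z = (m, z.2) := by rw [h]
          have h4 := h2 z.2 (e ▸ hz) (e ▸ .refl)
          have h5 := h3 z.2 (e ▸ hz') (e ▸ .refl)
          omega
      refine ⟨hm, fun q hq hqz => ?_, fun q hq hqz => ?_⟩
      · obtain ⟨p, h4, h5, h6⟩ := hA.exists_down (m := m) hq hrow (by simp)
        have h7 := h2 p h4 ((h6.head h5).trans hqz)
        -- A path that enters row `m + 1` to the left of column `c` and gets at least as far as `c`
        -- passes through `(m + 1, c)`.
        by_contra hc
        exact hn1' ((h4.tail h5).trans (hA.horizontal h6 h7.le (by simpa using hc)).1)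
      · obtain ⟨p, h4, h5, h6⟩ := hA.exists_down (m := m) hq hrow (by simp)
        exact (h3 p h4 ((h6.head h5).trans hqz)).trans_le (hA.le h6).2
    · rintro ⟨h1, h2, h3⟩
      simp only at h1 h2 h3
      refine ⟨by simp only; omega, fun q hq hqz => ?_, fun q hq hqz => ?_⟩
      · obtain ⟨p, h4, h5, h6⟩ := hA.exists_down (m := m) hqz le_rfl (by omega)
        exact lt_of_le_of_lt (hA.le h4).2 (h2 p ((hq.trans h4).tail h5) h6)
      · obtain ⟨p, h4, h5, h6⟩ := hA.exists_down (m := m) hqz le_rfl (by omega)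
        have h7 := h3 p ((hq.trans h4).tail h5) h6
        by_contra hc
        exact hn2 (hq.trans (hA.horizontal h4 (by simpa using hc) h7.le).1)
  · subst e
    simp only at *
    constructor
    · rintro ⟨h1, h2, h3⟩
      refine ⟨h1, fun q hq hqz => (h2 q hq hqz).trans (Nat.lt_succ_self _), fun q hq hqz => ?_⟩
      rcases (Nat.succ_le_of_lt (h3 q hq hqz)).lt_or_eq with h | h
      · exact h
      · subst h; exact absurd hq hn2'
    · rintro ⟨h1, h2, h3⟩
      refine ⟨h1, fun q hq hqz => ?_, fun q hq hqz => (Nat.lt_succ_self _).trans (h3 q hq hqz)⟩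
      rcases (Nat.le_of_lt_succ (h2 q hq hqz)).lt_or_eq with h | h
      · exact h
      · subst h; exact absurd hq hn1

theorem between_iff_of_eqvGen (hA : IsGridRel A) {r i i' : ℕ} {z w w' : ℕ × ℕ}
    (hrow : ∀ p q, A p q → r ≤ p.1)
    (hz : ReflTransGen A (r, i) z) (hz' : ReflTransGen A (r, i') z)
    (hw : EqvGen A w w') (hn : ¬ EqvGen A (r, i) w) :
    Between A (r, i) (r, i') z w ↔ Between A (r, i) (r, i') z w' := by
  induction hw with
  | rel x y h => exact hA.between_iff_of_step hz hz' (hrow _ _ h) h hn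
  | refl x => rfl
  | symm x y h ih => exact (ih fun h' => hn (h'.trans _ _ _ h)).symm
  | trans x y w h1 h2 ih1 ih2 =>
    exact (ih1 hn).trans (ih2 fun h' => hn (h'.trans _ _ _ (h1.symm _ _)))

/-- If two vertices of row `r` have a common descendant, then no other component contains
vertices of row `r` both between them and outside. -/
theorem trapped (hA : IsGridRel A) {r i i' c c' : ℕ} {z : ℕ × ℕ}
    (hrow : ∀ p q, A p q → r ≤ p.1)
    (hz : ReflTransGen A (r, i) z) (hz' : ReflTransGen A (r, i') z)
    (hw : EqvGen A (r, c) (r, c')) (hn : ¬ EqvGen A (r, i) (r, c)) (h1 : i < c) (h2 : c < i') :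
    i < c' ∧ c' < i' := by
  have hB : Between A (r, i) (r, i') z (r, c) := by
    refine ⟨(hA.le hz).1, fun q hq _ => ?_, fun q hq _ => h2.trans_le (hA.le hq).2⟩
    by_contra hc
    exact hn (eqvGen_of_reflTransGen (hA.horizontal hq h1.le (by simpa using hc)).1)
  have hB' := (hA.between_iff_of_eqvGen hrow hz hz' hw hn).1 hB
  exact ⟨hB'.2.1 i .refl hz, hB'.2.2 i' .refl hz'⟩

end IsGridRel

end GridFlow

namespace GridFlow

open Relation

/-! ### Separating the two sides of an arc -/

/-- The least order-connected set containing `S`. -/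
def rowHull (S : Set ℕ) : Set ℕ := {t | (∃ s ∈ S, s ≤ t) ∧ ∃ s ∈ S, t ≤ s}

theorem ordConnected_rowHull (S : Set ℕ) : (rowHull S).OrdConnected := by
  refine ⟨?_⟩
  rintro x ⟨⟨s, hs, h1⟩, _⟩ y ⟨_, ⟨s', hs', h2⟩⟩ z ⟨hz, hz'⟩
  exact ⟨⟨s, hs, h1.trans hz⟩, ⟨s', hs', hz'.trans h2⟩⟩

theorem subset_rowHull {S : Set ℕ} {t : ℕ} (h : t ∈ S) : t ∈ rowHull S :=
  ⟨⟨t, h, le_rfl⟩, ⟨t, h, le_rfl⟩⟩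

/-- The points outside `X` that are not separated from `y` by `X`, where the unbounded gaps
to the left and to the right of `X` are identified. -/
def gap (X : Set ℕ) (y : ℕ) : Set ℕ :=
  {j | j ∉ X ∧ ∀ x ∈ X, ∀ x' ∈ X, ((j < x ↔ y < x) ↔ (j < x' ↔ y < x'))}

/-- If `X` has elements on both sides of `y`, the gap is an interval between them. Otherwise `y`
lies in one of the two outer gaps, which count as one, and the complement is the convex hull of `X`.
-/
theorem ordConnected_gap (X : Set ℕ) {y : ℕ} (hy : y ∉ X) :
    (gap X y).OrdConnected ∨ (gap X y)ᶜ.OrdConnected := by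
  by_cases h : (∃ x ∈ X, x < y) ∧ ∃ x ∈ X, y < x
  · left
    obtain ⟨⟨a, ha, hay⟩, ⟨b, hb, hyb⟩⟩ := h
    -- A point that compares differently from `y` with one element of `X` does so with all of them.
    -- With `a < y < b` it would lie to the left of `a` but not of `b`.
    have key : ∀ j ∈ gap X y, ∀ x ∈ X, (j < x ↔ y < x) := by
      rintro j ⟨h1, h2⟩ x hx
      have h3 := h2 a ha b hb
      have h4 := h2 a ha x hx
      by_contra hc
      have : ¬ (j < a ↔ y < a) := fun h => hc (h4.1 h)
      have : ¬ (j < b ↔ y < b) := fun h => this (h3.2 h)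
      omega
    refine ⟨?_⟩
    intro j1 hj1 j2 hj2 j ⟨h1, h2⟩
    have hj : ∀ x ∈ X, (j < x ↔ y < x) := by
      intro x hx
      have := key j1 hj1 x hx
      have := key j2 hj2 x hx
      omega
    refine ⟨fun hjX => ?_, fun x hx x' hx' => iff_of_true (hj x hx) (hj x' hx')⟩
    have h3 := key j1 hj1 j hjX
    have h4 := key j2 hj2 j hjX
    have : j1 = j := by omega
    exact hj1.1 (this ▸ hjX)
  · right
    have hside : (∀ x ∈ X, y < x) ∨ ∀ x ∈ X, ¬ y < x := by
      by_cases h1 : ∃ x ∈ X, x < y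
      · exact Or.inr fun x hx h2 => h ⟨h1, x, hx, h2⟩
      · left
        intro x hx
        have : ¬ x < y := fun h2 => h1 ⟨x, hx, h2⟩
        have : x ≠ y := fun h2 => hy (h2 ▸ hx)
        omega
    have mem : ∀ j, j ∈ (gap X y)ᶜ ↔ j ∈ X ∨ (∃ x ∈ X, x < j) ∧ ∃ x ∈ X, j < x := by
      intro j
      constructor
      · intro hj
        by_cases hjX : j ∈ X
        · exact Or.inl hjX
        right
        by_contra hc
        refine hj ⟨hjX, fun x hx x' hx' => ?_⟩
        have hne : x ≠ j := fun h => hjX (h ▸ hx)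
        have hne' : x' ≠ j := fun h => hjX (h ▸ hx')
        have h2 : j < x ↔ j < x' := by
          constructor
          · intro h3
            by_contra h4
            exact hc ⟨⟨x', hx', by omega⟩, ⟨x, hx, h3⟩⟩
          · intro h3
            by_contra h4
            exact hc ⟨⟨x, hx, by omega⟩, ⟨x', hx', h3⟩⟩
        rcases hside with h3 | h3 <;> simp [h3 x hx, h3 x' hx', h2]
      · rintro (hj | ⟨⟨x, hx, h1⟩, ⟨x', hx', h2⟩⟩) ⟨h3, h4⟩
        · exact h3 hj
        · have := h4 x hx x' hx'
          rcases hside with h5 | h5 <;> have := h5 x hx <;> have := h5 x' hx' <;> omega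
    refine ⟨?_⟩
    intro j1 hj1 j2 hj2 j ⟨h1, h2⟩
    rw [mem] at *
    by_cases hjX : j ∈ X
    · exact Or.inl hjX
    have e1 : ∃ x ∈ X, x ≤ j1 := by
      rcases hj1 with h | ⟨⟨x, hx, h⟩, _⟩
      exacts [⟨_, h, le_rfl⟩, ⟨x, hx, h.le⟩]
    have e2 : ∃ x ∈ X, j2 ≤ x := by
      rcases hj2 with h | ⟨_, ⟨x, hx, h⟩⟩
      exacts [⟨_, h, le_rfl⟩, ⟨x, hx, h.le⟩]
    obtain ⟨x, hx, hx1⟩ := e1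
    obtain ⟨x', hx', hx1'⟩ := e2
    have hne : x ≠ j := fun h => hjX (h ▸ hx)
    have hne' : x' ≠ j := fun h => hjX (h ▸ hx')
    exact Or.inr ⟨⟨x, hx, by omega⟩, ⟨x', hx', by omega⟩⟩

/-! ### Components and their traces on the rows -/

namespace IsGridRel

variable {A : ℕ × ℕ → ℕ × ℕ → Prop}

/-- Inside a component all of whose vertices are reached from row `r`, the vertices of row `r`
are connected through common descendants. -/
theorem reflTransGen_common {r : ℕ} {v : ℕ × ℕ} {Act : ℕ × ℕ → Prop}
    (hact : ∀ p q, A p q → Act p ∧ Act q)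
    (hreach : ∀ z, Act z → (∃ j, ReflTransGen A (r, j) z) ∨ ReflTransGen A v z)
    {p q : ℕ × ℕ} (h : EqvGen A p q) :
    (Act p ↔ Act q) ∧ (Act p → ¬ EqvGen A v p → ∀ i j, ReflTransGen A (r, i) p →
      ReflTransGen A (r, j) q → ReflTransGen
        (fun i j => ∃ z, ReflTransGen A (r, i) z ∧ ReflTransGen A (r, j) z) i j) := by
  induction h with
  | rel x y h =>
    exact ⟨iff_of_true (hact _ _ h).1 (hact _ _ h).2,
      fun _ _ i j hi hj => .single ⟨y, hi.tail h, hj⟩⟩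
  | refl x => exact ⟨Iff.rfl, fun _ _ i j hi hj => .single ⟨x, hi, hj⟩⟩
  | symm x y h ih =>
    refine ⟨ih.1.symm, fun h1 h2 i j hi hj => ?_⟩
    refine ReflTransGen.mono ?_ _ _
      (ih.2 (ih.1.2 h1) (fun h3 => h2 (h3.trans _ _ _ h)) j i hj hi).swap
    rintro a b ⟨z, h3, h4⟩
    exact ⟨z, h4, h3⟩
  | trans x y z h1 h2 ih1 ih2 =>
    refine ⟨ih1.1.trans ih2.1, fun h3 h4 i j hi hj => ?_⟩
    have hy := ih1.1.1 h3
    have hvy : ¬ EqvGen A v y := fun h5 => h4 (h5.trans _ _ _ (h1.symm _ _))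
    rcases hreach y hy with ⟨k, hk⟩ | hk
    · exact (ih1.2 h3 h4 i k hi hk).trans (ih2.2 hy hvy k j hk hj)
    · exact absurd (eqvGen_of_reflTransGen hk) hvy

/-- The row-`r` vertices of the component of `u` are linked by a chain in which neighbours have a
common descendant. By `trapped`, the interval between two neighbours contains both of `j`, `j'` or
neither, so whether `x` separates `j` from `j'` does not change along the chain. -/
theorem gap_closed (hA : IsGridRel A) {r : ℕ} {u v : ℕ × ℕ} {Act : ℕ × ℕ → Prop}
    (hrow : ∀ p q, A p q → r ≤ p.1)
    (hact : ∀ p q, A p q → Act p ∧ Act q)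
    (hreach : ∀ z, Act z → (∃ j, ReflTransGen A (r, j) z) ∨ ReflTransGen A v z)
    (hu : Act u) (huv : ¬ EqvGen A u v) {j j' : ℕ} (h : EqvGen A (r, j) (r, j'))
    (hj : ¬ EqvGen A u (r, j)) :
    ∀ x, EqvGen A u (r, x) → ∀ x', EqvGen A u (r, x') →
      ((j < x ↔ j' < x) ↔ (j < x' ↔ j' < x')) := by
  intro x hx x' hx'
  have hxx : EqvGen A (r, x) (r, x') := (hx.symm _ _).trans _ _ _ hx'
  have hxAct : Act (r, x) := (reflTransGen_common hact hreach hx).1.1 hu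
  have hvx : ¬ EqvGen A v (r, x) := fun h => huv (hx.trans _ _ _ (h.symm _ _))
  have hB := (reflTransGen_common hact hreach hxx).2 hxAct hvx x x' .refl .refl
  clear hx' hxx
  have hj' : ¬ EqvGen A u (r, j') := fun h' => hj (h'.trans _ _ _ (h.symm _ _))
  have main : ∀ a b, EqvGen A u (r, a) →
      (∃ z, ReflTransGen A (r, a) z ∧ ReflTransGen A (r, b) z) →
      ∀ k k', EqvGen A (r, k) (r, k') → ¬ EqvGen A u (r, k) → a < k → k < b →
      a < k' ∧ k' < b := by
    rintro a b ha ⟨z, h1, h2⟩ k k' hkk hk h3 h4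
    exact hA.trapped hrow h1 h2 hkk (fun h5 => hk (ha.trans _ _ _ h5)) h3 h4
  induction hB with
  | refl => rfl
  | @tail a b h1 h2 ih =>
    refine ih.trans ?_
    have ha : EqvGen A u (r, a) := by
      refine hx.trans _ _ _ ?_
      clear ih h2
      induction h1 with
      | refl => exact .refl _
      | tail _ h ih =>
        obtain ⟨z, h3, h4⟩ := h
        exact ih.trans _ _ _ (eqvGen_of_common h3 h4)
    obtain ⟨z, h3, h4⟩ := h2
    have hb : EqvGen A u (r, b) := ha.trans _ _ _ (eqvGen_of_common h3 h4)
    have m1 := main a b ha ⟨z, h3, h4⟩ j j' h hj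
    have m2 := main a b ha ⟨z, h3, h4⟩ j' j (h.symm _ _) hj'
    have m3 := main b a hb ⟨z, h4, h3⟩ j j' h hj
    have m4 := main b a hb ⟨z, h4, h3⟩ j' j (h.symm _ _) hj'
    have n1 : a ≠ j := by rintro rfl; exact hj ha
    have n2 : b ≠ j := by rintro rfl; exact hj hb
    have n3 : a ≠ j' := by rintro rfl; exact hj' ha
    have n4 : b ≠ j' := by rintro rfl; exact hj' hb
    omega

/-- `G` is the gap, left in row `r` by the component of `u`, that holds the row-`r` vertices of the
component of `v`. It is empty if that component misses row `r`. -/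
theorem exists_side (hA : IsGridRel A) {r : ℕ} {u v : ℕ × ℕ} {Act : ℕ × ℕ → Prop}
    (hrow : ∀ p q, A p q → r ≤ p.1)
    (hact : ∀ p q, A p q → Act p ∧ Act q)
    (hreach : ∀ z, Act z → (∃ j, ReflTransGen A (r, j) z) ∨ ReflTransGen A v z)
    (hu : Act u) (huv : ¬ EqvGen A u v) :
    ∃ G : Set ℕ, (G.OrdConnected ∨ Gᶜ.OrdConnected) ∧ (∀ j ∈ G, ¬ EqvGen A u (r, j)) ∧
      (∀ j j', EqvGen A (r, j) (r, j') → j ∈ G → j' ∈ G) ∧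
      (∀ j, EqvGen A (r, j) v → j ∈ G) := by
  by_cases hY : ∃ y, EqvGen A (r, y) v
  · obtain ⟨y, hy⟩ := hY
    have hyX : ¬ EqvGen A u (r, y) := fun h => huv (h.trans _ _ _ hy)
    refine ⟨gap {x | EqvGen A u (r, x)} y, ordConnected_gap _ hyX, fun j hj => hj.1, ?_, ?_⟩
    · rintro j j' h ⟨h1, h2⟩
      refine ⟨fun h3 => h1 (h3.trans _ _ _ (h.symm _ _)), fun x hx x' hx' => ?_⟩
      have h3 := h2 x hx x' hx'
      have h4 := hA.gap_closed hrow hact hreach hu huv h h1 x hx x' hx'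
      tauto
    · intro j hj
      have h1 : EqvGen A (r, j) (r, y) := hj.trans _ _ _ (hy.symm _ _)
      have h2 : ¬ EqvGen A u (r, j) := fun h => huv (h.trans _ _ _ hj)
      exact ⟨h2, fun x hx x' hx' => hA.gap_closed hrow hact hreach hu huv h1 h2 x hx x' hx'⟩
  · exact ⟨∅, Or.inl Set.ordConnected_empty, by simp, by simp, fun j hj => hY ⟨j, hj⟩⟩

/-- Either `j` lies between two elements of `P`, or its path to `(l, t)` crosses a path from an
element of `P`, which puts `j` in the same component as that element. -/
theorem mem_of_anchored (hA : IsGridRel A) {r : ℕ} {P : Set ℕ} (hP : P.OrdConnected)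
    (hcl : ∀ j j', EqvGen A (r, j) (r, j') → j ∈ P → j' ∈ P) {l t j : ℕ}
    (ht : t ∈ rowHull {t | ∃ j ∈ P, ReflTransGen A (r, j) (l, t)})
    (hj : ReflTransGen A (r, j) (l, t)) : j ∈ P := by
  obtain ⟨⟨t1, ⟨j1, hj1, h1⟩, ht1⟩, ⟨t2, ⟨j2, hj2, h2⟩, ht2⟩⟩ := ht
  rcases le_total j j1 with h3 | h3
  · exact hcl _ _ ((hA.crossing hj h1 h3 ht1).symm _ _) hj1
  rcases le_total j2 j with h4 | h4
  · exact hcl _ _ (hA.crossing h2 hj h4 ht2) hj2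
  exact hP.out hj1 hj2 ⟨h3, h4⟩

/-- The path from row `r` passes through the row of `v`. From there on it must meet one of the two
paths that lead from `v` to either side of `(l, t)`. -/
theorem eqvGen_of_mem_rowHull (hA : IsGridRel A) {r : ℕ} {v : ℕ × ℕ} (hv : r ≤ v.1) {l t j : ℕ}
    (ht : t ∈ rowHull {t | ReflTransGen A v (l, t)}) (hj : ReflTransGen A (r, j) (l, t)) :
    EqvGen A v (l, t) := by
  obtain ⟨⟨t1, h1, ht1⟩, ⟨t2, h2, ht2⟩⟩ := ht
  obtain ⟨c, h3, h4⟩ := hA.exists_row hj hv (hA.le h1).1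
  obtain ⟨m, d⟩ := v
  refine EqvGen.trans _ (m, c) _ ?_ (eqvGen_of_reflTransGen h4)
  rcases le_total c d with h5 | h5
  · exact (hA.crossing h4 h1 h5 ht1).symm _ _
  · exact hA.crossing h2 h4 h5 ht2

/-- There is a union of components, separating `u` from `v`, that meets row `r` in an interval
and every later row in a union or a difference of two intervals. -/
theorem exists_separating (hA : IsGridRel A) {r : ℕ} {u v : ℕ × ℕ} {Act : ℕ × ℕ → Prop}
    (hrow : ∀ p q, A p q → r ≤ p.1)
    (hact : ∀ p q, A p q → Act p ∧ Act q)
    (hreach : ∀ z, Act z → (∃ j, ReflTransGen A (r, j) z) ∨ ReflTransGen A v z)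
    (hu : Act u) (huv : ¬ EqvGen A u v) (hv : r ≤ v.1) :
    ∃ W : Set (ℕ × ℕ), (∀ p q, A p q → (p ∈ W ↔ q ∈ W)) ∧ ¬ (u ∈ W ↔ v ∈ W) ∧
      (∃ I : Set ℕ, I.OrdConnected ∧ ∀ t, (r, t) ∈ W ↔ t ∈ I) ∧
      ∀ l, ∃ I J : Set ℕ, I.OrdConnected ∧ J.OrdConnected ∧
        ((∀ t, Act (l, t) → ((l, t) ∈ W ↔ t ∈ I ∪ J)) ∨
         (∀ t, Act (l, t) → ((l, t) ∈ W ↔ t ∈ I \ J))) := by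
  obtain ⟨G, hG, hGu, hGcl, hGv⟩ := hA.exists_side hrow hact hreach hu huv
  -- The component of `v` is added separately because it need not meet row `r`.
  set W : Set (ℕ × ℕ) := {p | (∃ j ∈ G, EqvGen A (r, j) p) ∨ EqvGen A v p} with hW
  have hcl : ∀ p q, EqvGen A p q → p ∈ W → q ∈ W := by
    rintro p q h (⟨j, hj, h1⟩ | h1)
    · exact Or.inl ⟨j, hj, h1.trans _ _ _ h⟩
    · exact Or.inr (h1.trans _ _ _ h)
  have hstep : ∀ p q, A p q → (p ∈ W ↔ q ∈ W) := fun p q h =>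
    ⟨hcl _ _ (.rel _ _ h), hcl _ _ ((EqvGen.rel _ _ h).symm _ _)⟩
  have huW : u ∉ W := by
    rintro (⟨j, hj, h⟩ | h)
    · exact hGu j hj (h.symm _ _)
    · exact huv (h.symm _ _)
  have hvW : v ∈ W := Or.inr (.refl _)
  have htop : ∀ t, (r, t) ∈ W ↔ t ∈ G := by
    refine fun t => ⟨?_, fun h => Or.inl ⟨t, h, .refl _⟩⟩
    rintro (⟨j, hj, h⟩ | h)
    · exact hGcl _ _ h hj
    · exact hGv t (h.symm _ _)
  have hanch : ∀ {j p}, ReflTransGen A (r, j) p → (p ∈ W ↔ j ∈ G) := fun {j p} h => by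
    rw [← htop]
    exact ⟨hcl _ _ ((eqvGen_of_reflTransGen h).symm _ _), hcl _ _ (eqvGen_of_reflTransGen h)⟩
  have hD : ∀ l t, Act (l, t) → t ∈ rowHull {t | ReflTransGen A v (l, t)} → (l, t) ∈ W := by
    intro l t h1 h2
    rcases hreach _ h1 with ⟨j, hj⟩ | h3
    · exact Or.inr (hA.eqvGen_of_mem_rowHull hv h2 hj)
    · exact Or.inr (eqvGen_of_reflTransGen h3)
  rcases hG with hG | hG
  · refine ⟨W, hstep, by simp [huW, hvW], ⟨G, hG, htop⟩, fun l => ⟨_, _,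
      ordConnected_rowHull {t | ∃ j ∈ G, ReflTransGen A (r, j) (l, t)},
      ordConnected_rowHull {t | ReflTransGen A v (l, t)}, Or.inl fun t ht => ⟨fun h => ?_, ?_⟩⟩⟩
    · rcases hreach _ ht with ⟨j, hj⟩ | h3
      · exact Or.inl (subset_rowHull ⟨j, (hanch hj).1 h, hj⟩)
      · exact Or.inr (subset_rowHull h3)
    · rintro (h | h)
      · rcases hreach _ ht with ⟨j, hj⟩ | h3
        · exact (hanch hj).2 (hA.mem_of_anchored hG hGcl h hj)
        · exact Or.inr (eqvGen_of_reflTransGen h3)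
      · exact hD l t ht h
  -- If only the complement of `G` is an interval, the complement of `W` is used. The descendants of
  -- `v` are then cut out of the hull instead of being added, whence the difference.
  · have hGcl' : ∀ j j', EqvGen A (r, j) (r, j') → j ∈ Gᶜ → j' ∈ Gᶜ :=
      fun j j' h h1 h2 => h1 (hGcl _ _ (h.symm _ _) h2)
    refine ⟨Wᶜ, fun p q h => not_congr (hstep p q h), by simp [huW, hvW],
      ⟨Gᶜ, hG, fun t => not_congr (htop t)⟩, fun l => ⟨_, _,
      ordConnected_rowHull {t | ∃ j ∈ Gᶜ, ReflTransGen A (r, j) (l, t)},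
      ordConnected_rowHull {t | ReflTransGen A v (l, t)}, Or.inr fun t ht => ⟨fun h => ?_, ?_⟩⟩⟩
    · rcases hreach _ ht with ⟨j, hj⟩ | h3
      · exact ⟨subset_rowHull ⟨j, fun h1 => h ((hanch hj).2 h1), hj⟩, fun h1 => h (hD l t ht h1)⟩
      · exact absurd (Or.inr (eqvGen_of_reflTransGen h3)) h
    · rintro ⟨h, h'⟩ h1
      rcases hreach _ ht with ⟨j, hj⟩ | h3
      · exact hA.mem_of_anchored hG hGcl' h hj ((hanch hj).1 h1)
      · exact h' (subset_rowHull h3)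

end IsGridRel

end GridFlow

namespace GridFlow

open Relation

/-! ### Sums over intervals -/

/-- `x` is a sum of `β` over a (possibly empty) interval of `{0, …, T - 1}`. -/
def IsIntervalSum (β : ℕ → ℝ) (T : ℕ) (x : ℝ) : Prop :=
  x = 0 ∨ ∃ i j, i ≤ j ∧ j < T ∧ x = ∑ t ∈ Finset.Ico i (j + 1), β t

open Classical in
theorem isIntervalSum_of_ordConnected (β : ℕ → ℝ) (T : ℕ) {I : Set ℕ} (hI : I.OrdConnected) :
    IsIntervalSum β T (∑ t ∈ Finset.range T, if t ∈ I then β t else 0) := by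
  rw [← Finset.sum_filter]
  set F := (Finset.range T).filter (· ∈ I) with hF
  rcases F.eq_empty_or_nonempty with h | h
  · left; simp [h]
  · right
    have h1 := F.min'_mem h
    have h2 := F.max'_mem h
    have h3 : ∀ t ∈ F, F.min' h ≤ t ∧ t ≤ F.max' h := fun t ht => ⟨F.min'_le t ht, F.le_max' t ht⟩
    set i := F.min' h
    set j := F.max' h
    have h1' := Finset.mem_filter.1 h1
    have h2' := Finset.mem_filter.1 h2
    refine ⟨i, j, (h3 i h1).2, Finset.mem_range.1 h2'.1, Finset.sum_congr ?_ fun _ _ => rfl⟩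
    ext t
    rw [Finset.mem_Ico, Nat.lt_succ_iff]
    refine ⟨h3 t, fun ht => Finset.mem_filter.2 ⟨?_, hI.out h1'.2 h2'.2 ht⟩⟩
    exact Finset.mem_range.2 (ht.2.trans_lt (Finset.mem_range.1 h2'.1))

/-- Two intervals that meet have an interval as their union. Disjointness lets the sum over the
union split into two interval sums. -/
theorem exists_disjoint_union {I J : Set ℕ} (hI : I.OrdConnected) (hJ : J.OrdConnected) :
    ∃ I' J' : Set ℕ, I'.OrdConnected ∧ J'.OrdConnected ∧ Disjoint I' J' ∧ I ∪ J = I' ∪ J' := by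
  by_cases h : Disjoint I J
  · exact ⟨I, J, hI, hJ, h, rfl⟩
  · obtain ⟨s, hs, hs'⟩ := Set.not_disjoint_iff.1 h
    refine ⟨I ∪ J, ∅, ⟨?_⟩, Set.ordConnected_empty, by simp, by simp⟩
    have key : ∀ x ∈ I ∪ J, ∀ z, (x ≤ z ∧ z ≤ s) ∨ (s ≤ z ∧ z ≤ x) → z ∈ I ∪ J := by
      rintro x (hx | hx) z (hz | hz)
      · exact Or.inl (hI.out hx hs hz)
      · exact Or.inl (hI.out hs hx hz)
      · exact Or.inr (hJ.out hx hs' hz)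
      · exact Or.inr (hJ.out hs' hx hz)
    intro x hx y hy z hz
    rcases le_total z s with h1 | h1
    · exact key x hx z (Or.inl ⟨hz.1, h1⟩)
    · exact key y hy z (Or.inr ⟨h1, hz.2⟩)

/-- For nonempty `J`, the two pieces are the parts of `I` to the left and to the right of all of
`J`. -/
theorem exists_disjoint_union_diff {I J : Set ℕ} (hI : I.OrdConnected) (hJ : J.OrdConnected) :
    ∃ I' J' : Set ℕ, I'.OrdConnected ∧ J'.OrdConnected ∧ Disjoint I' J' ∧ I \ J = I' ∪ J' := by
  rcases J.eq_empty_or_nonempty with rfl | ⟨s, hs⟩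
  · exact ⟨I, ∅, hI, Set.ordConnected_empty, by simp, by simp⟩
  · refine ⟨I ∩ {t | ∀ s ∈ J, t < s}, I ∩ {t | ∀ s ∈ J, s < t}, ?_, ?_, ?_, ?_⟩
    · refine hI.inter ⟨fun x hx y hy z hz s hs => hz.2.trans_lt (hy s hs)⟩
    · refine hI.inter ⟨fun x hx y hy z hz s hs => (hx s hs).trans_le hz.1⟩
    · rw [Set.disjoint_left]
      rintro t ⟨_, h1⟩ ⟨_, h2⟩
      exact lt_asymm (h1 s hs) (h2 s hs)
    · ext t
      constructor
      · rintro ⟨h1, h2⟩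
        by_contra hc
        have h3 : ∃ s ∈ J, s ≤ t := by
          by_contra h3
          push Not at h3
          exact hc (Or.inl ⟨h1, h3⟩)
        have h4 : ∃ s ∈ J, t ≤ s := by
          by_contra h4
          push Not at h4
          exact hc (Or.inr ⟨h1, h4⟩)
        obtain ⟨s1, hs1, h5⟩ := h3
        obtain ⟨s2, hs2, h6⟩ := h4
        exact h2 (hJ.out hs1 hs2 ⟨h5, h6⟩)
      · rintro (⟨h1, h2⟩ | ⟨h1, h2⟩)
        · exact ⟨h1, fun h => lt_irrefl _ (h2 t h)⟩
        · exact ⟨h1, fun h => lt_irrefl _ (h2 t h)⟩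

/-! ### Flows -/

/-- The coordinates of a vertex. -/
def coord {L T : ℕ} (v : Vertex L T) : ℕ × ℕ := (v.1, v.2)

theorem coord_injective {L T : ℕ} : Function.Injective (coord : Vertex L T → ℕ × ℕ) := by
  rintro ⟨l, t⟩ ⟨l', t'⟩ h
  simp only [coord, Prod.mk.injEq] at h
  exact Prod.ext (Fin.ext h.1) (Fin.ext h.2)

variable {L T : ℕ}

/-- Net outflow of `g` at `v`. -/
noncomputable def netOutflow (g : Arc L T → ℝ) (v : Vertex L T) : ℝ :=
  ∑ a with Arc.tail a = v, g a - ∑ a with Arc.head a = v, g a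

/-- Summation by parts. With `w` the indicator of a vertex set, only arcs across the cut remain. -/
theorem sum_mul_netOutflow (g : Arc L T → ℝ) (w : Vertex L T → ℝ) :
    ∑ v, w v * netOutflow g v = ∑ e, g e * (w (Arc.tail e) - w (Arc.head e)) := by
  have h : ∀ φ : Arc L T → Vertex L T,
      ∑ v, w v * ∑ e with φ e = v, g e = ∑ e, g e * w (φ e) := by
    intro φ
    rw [← Finset.sum_fiberwise Finset.univ φ]
    refine Finset.sum_congr rfl fun v _ => ?_
    rw [Finset.mul_sum]
    refine Finset.sum_congr rfl fun e he => ?_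
    rw [(Finset.mem_filter.1 he).2, mul_comm]
  simp only [netOutflow, mul_sub, Finset.sum_sub_distrib, h]

theorem netOutflow_add (g g' : Arc L T → ℝ) (v : Vertex L T) :
    netOutflow (g + g') v = netOutflow g v + netOutflow g' v := by
  simp only [netOutflow, Pi.add_apply, Finset.sum_add_distrib]; ring

theorem netOutflow_smul (c : ℝ) (g : Arc L T → ℝ) (v : Vertex L T) :
    netOutflow (c • g) v = c * netOutflow g v := by
  simp only [netOutflow, Pi.smul_apply, smul_eq_mul, ← Finset.mul_sum]; ring

theorem netOutflow_single (e : Arc L T) (v : Vertex L T) :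
    netOutflow (Pi.single e 1) v =
      (if coord v = coord e.tail then 1 else 0) - if coord v = coord e.head then 1 else 0 := by
  simp only [netOutflow, coord_injective.eq_iff, Finset.sum_filter, Pi.single_apply]
  congr 1 <;>
  · rw [Finset.sum_eq_single e]
    · simp [eq_comm]
    · intro b _ hb; simp [hb]
    · simp

/-- The arcs with positive flow other than `a`, as a relation between coordinates. -/
def posRel (f : Arc L T → ℝ) (a : Arc L T) (p q : ℕ × ℕ) : Prop :=
  ∃ e : Arc L T, e ≠ a ∧ 0 < f e ∧ coord e.tail = p ∧ coord e.head = q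

theorem isGridRel_of_arc {E : ℕ × ℕ → ℕ × ℕ → Prop}
    (h : ∀ p q, E p q → ∃ e : Arc L T, coord e.tail = p ∧ coord e.head = q) : IsGridRel E := by
  intro p q hpq
  obtain ⟨e, rfl, rfl⟩ := h p q hpq
  rcases e.2 with ⟨h1, h2⟩ | ⟨h1, h2⟩
  · exact Or.inl (Prod.ext h1 (congrArg Fin.val h2))
  · exact Or.inr (Prod.ext (congrArg Fin.val h1) h2)

/-- A unit of flow is sent along an undirected path in the support; arcs traversed backwards get a
negative sign. -/
theorem exists_flow_of_eqvGen (f : Arc L T → ℝ) (a : Arc L T) {p q : ℕ × ℕ}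
    (h : EqvGen (posRel f a) p q) :
    ∃ g : Arc L T → ℝ, g a = 0 ∧ (∀ e, g e ≠ 0 → 0 < f e) ∧ ∀ v, netOutflow g v =
      (if coord v = p then 1 else 0) - if coord v = q then 1 else 0 := by
  induction h with
  | rel p q h =>
    obtain ⟨e, hea, he, rfl, rfl⟩ := h
    refine ⟨Pi.single e 1, by simp [Ne.symm hea], fun e' he' => ?_, netOutflow_single e⟩
    by_cases h : e' = e
    · exact h ▸ he
    · simp [h] at he'
  | refl p => exact ⟨0, rfl, by simp, fun v => by simp [netOutflow]⟩
  | symm p q _ ih =>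
    obtain ⟨g, h1, h2, h3⟩ := ih
    refine ⟨(-1 : ℝ) • g, by simp [h1], fun e he => h2 e (by simpa using he), fun v => ?_⟩
    rw [netOutflow_smul, h3]; ring
  | trans p q s _ _ ih1 ih2 =>
    obtain ⟨g, h1, h2, h3⟩ := ih1
    obtain ⟨g', h1', h2', h3'⟩ := ih2
    refine ⟨g + g', by simp [h1, h1'], fun e he => ?_, fun v => ?_⟩
    · by_cases h : g e = 0
      · exact h2' e (by simpa [h] using he)
      · exact h2 e h
    · rw [netOutflow_add, h3, h3']; ring

/-! ### Extreme points, cuts and the shape of extreme flow values -/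

namespace MFG

theorem mem_flowPolyhedron (I : MFG L T) (hU : I.IsUncapacitated) {x : Arc L T → ℝ} :
    x ∈ I.flowPolyhedron ↔ (∀ v, netOutflow x v = I.b v) ∧ ∀ e, 0 ≤ x e := by
  refine ⟨fun h => ⟨h.1, fun e => (h.2 e).1⟩, fun h => ⟨h.1, fun e => ⟨h.2 e, fun k hk => ?_⟩⟩⟩
  simp [hU e] at hk

/-- A circulation on the support of an extreme point vanishes. -/
theorem eq_zero_of_circulation (I : MFG L T) (hU : I.IsUncapacitated) {f : Arc L T → ℝ}
    (hf : f ∈ Set.extremePoints ℝ I.flowPolyhedron) {h : Arc L T → ℝ}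
    (hs : ∀ e, h e ≠ 0 → 0 < f e) (hh : ∀ v, netOutflow h v = 0) : h = 0 := by
  have hfP := (I.mem_flowPolyhedron hU).1 hf.1
  -- There are finitely many arcs, so one `ε` keeps both `f + ε h` and `f - ε h` nonnegative. Their
  -- midpoint is `f`, and extremality forces `h = 0`.
  obtain ⟨ε, hε, hle⟩ : ∃ ε : ℝ, 0 < ε ∧ ∀ e, ε * |h e| ≤ f e := by
    have : ∀ e, ∀ᶠ ε : ℝ in nhdsWithin 0 (Set.Ioi 0), ε * |h e| ≤ f e := by
      intro e
      by_cases h0 : h e = 0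
      · simp [h0, hfP.2 e]
      · have hpos : 0 < |h e| := abs_pos.2 h0
        have : Set.Iio (f e / |h e|) ∈ nhdsWithin (0 : ℝ) (Set.Ioi 0) :=
          mem_nhdsWithin_of_mem_nhds (Iio_mem_nhds (div_pos (hs e h0) hpos))
        filter_upwards [this] with ε hε
        exact ((lt_div_iff₀ hpos).1 hε).le
    have h1 := (Filter.eventually_all.2 this).and
      (self_mem_nhdsWithin : Set.Ioi (0 : ℝ) ∈ nhdsWithin 0 (Set.Ioi 0))
    obtain ⟨ε, h2, h3⟩ := h1.exists
    exact ⟨ε, h3, h2⟩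
  have hmem : ∀ c : ℝ, |c| = ε → f + c • h ∈ I.flowPolyhedron := by
    intro c hc
    rw [I.mem_flowPolyhedron hU]
    refine ⟨fun v => by rw [netOutflow_add, netOutflow_smul, hh, hfP.1]; ring, fun e => ?_⟩
    have h1 : -(c * h e) ≤ |c * h e| := neg_le_abs _
    rw [abs_mul, hc] at h1
    have := hle e
    simp only [Pi.add_apply, Pi.smul_apply, smul_eq_mul]
    linarith
  have h1 := hmem ε (abs_of_pos hε)
  have h2 := hmem (-ε) (by rw [abs_neg, abs_of_pos hε])
  have h3 := hf.2 h1 h2 ⟨1 / 2, 1 / 2, by norm_num, by norm_num, by norm_num, by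
    ext e; simp; ring⟩
  ext e
  have h4 := congrFun h3 e
  simp only [Pi.add_apply, Pi.smul_apply, smul_eq_mul, add_eq_left, mul_eq_zero] at h4
  simpa [hε.ne'] using h4

theorem not_eqvGen_of_extreme (I : MFG L T) (hU : I.IsUncapacitated) {f : Arc L T → ℝ}
    (hf : f ∈ Set.extremePoints ℝ I.flowPolyhedron) {a : Arc L T} (ha : 0 < f a) :
    ¬ EqvGen (posRel f a) (coord a.tail) (coord a.head) := by
  intro h
  obtain ⟨g, h1, h2, h3⟩ := exists_flow_of_eqvGen f a h
  -- The arc `a` minus a unit flow from its tail to its head that avoids `a` is a circulation with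
  -- value 1 on `a`.
  have h0 := I.eq_zero_of_circulation hU hf (h := Pi.single a 1 + (-1 : ℝ) • g) (fun e he => ?_)
    (fun v => ?_)
  · have := congrFun h0 a
    simp [h1] at this
  · by_cases hea : e = a
    · exact hea ▸ ha
    · exact h2 e (by simpa [hea] using he)
  · rw [netOutflow_add, netOutflow_smul, netOutflow_single, h3]; ring

open Classical in
/-- If `a` is the only arc with positive flow across a cut, then its flow is the supply of
one side. -/
theorem sum_supply_eq (I : MFG L T) {f : Arc L T → ℝ}
    (hf : ∀ v, netOutflow f v = I.b v) (hf0 : ∀ e, 0 ≤ f e) (a : Arc L T) {W : Set (ℕ × ℕ)}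
    (hW : ∀ p q, posRel f a p q → (p ∈ W ↔ q ∈ W)) :
    ∑ v : Vertex L T, (if coord v ∈ W then (I.b v : ℝ) else 0) =
      f a * ((if coord a.tail ∈ W then 1 else 0) - if coord a.head ∈ W then 1 else 0) := by
  have h := sum_mul_netOutflow f fun v => if coord v ∈ W then (1 : ℝ) else 0
  rw [Finset.sum_eq_single a] at h
  · rw [← h]
    refine Finset.sum_congr rfl fun v _ => ?_
    rw [hf]; split_ifs <;> simp
  · intro e _ he
    rcases (hf0 e).lt_or_eq with h1 | h1
    · have := hW _ _ ⟨e, he, h1, rfl, rfl⟩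
      simp [this]
    · simp [← h1]
  · simp

/-- The arcs with positive flow, as a relation between coordinates. -/
def supportRel (f : Arc L T → ℝ) (p q : ℕ × ℕ) : Prop :=
  ∃ e : Arc L T, 0 < f e ∧ coord e.tail = p ∧ coord e.head = q

/-- Flow is traced upstream: a vertex that is not a source but has demand or outflow has an entering
arc with flow. Row plus column drops along the way, so the trace ends, and it can end only at a
source. -/
theorem exists_reach (I : MFG L T) {f : Arc L T → ℝ}
    (hf : ∀ v, netOutflow f v = I.b v) (hf0 : ∀ e, 0 ≤ f e) {r : ℕ}
    (hr : ∀ v : Vertex L T, 0 < I.b v → (v.1 : ℕ) = r) (v : Vertex L T)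
    (hv : I.b v ≠ 0 ∨ ∃ e : Arc L T, e.tail = v ∧ 0 < f e) :
    ∃ j, ReflTransGen (supportRel f) (r, j) (coord v) := by
  obtain ⟨n, hn⟩ : ∃ n, n = (v.1 : ℕ) + v.2 := ⟨_, rfl⟩
  induction n using Nat.strong_induction_on generalizing v with
  | _ n ih =>
    by_cases hb : 0 < I.b v
    · refine ⟨v.2, ?_⟩
      have : coord v = (r, (v.2 : ℕ)) := Prod.ext (hr v hb) rfl
      rw [this]
    · push Not at hb
      have hb' : (I.b v : ℝ) ≤ 0 := by exact_mod_cast hb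
      have h1 := hf v
      have hout : 0 ≤ ∑ e with Arc.tail e = v, f e := Finset.sum_nonneg fun e _ => hf0 e
      have hin : 0 < ∑ e with Arc.head e = v, f e := by
        unfold netOutflow at h1
        rcases hv with hv | ⟨e, he, hpos⟩
        · have : (I.b v : ℝ) < 0 := by exact_mod_cast lt_of_le_of_ne hb hv
          linarith
        · have : f e ≤ ∑ e with Arc.tail e = v, f e :=
            Finset.single_le_sum (fun e _ => hf0 e) (by simp [he])
          linarith
      obtain ⟨e, he, hpos⟩ : ∃ e ∈ Finset.univ.filter fun e : Arc L T => e.head = v, 0 < f e := by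
        by_contra! hc
        exact absurd (Finset.sum_nonpos hc) hin.not_ge
      have he' : e.head = v := (Finset.mem_filter.1 he).2
      have hlt : (e.tail.1 : ℕ) + e.tail.2 < n := by
        have := isGridRel_of_arc (L := L) (T := T)
          (E := fun p q => ∃ e : Arc L T, coord e.tail = p ∧ coord e.head = q)
          (fun _ _ h => h) _ _ ⟨e, rfl, rfl⟩
        rw [he'] at this
        rw [hn]
        simp only [coord, Prod.mk.injEq] at this
        omega
      obtain ⟨j, hj⟩ := ih _ hlt e.tail (Or.inr ⟨e, rfl, hpos⟩) rfl
      exact ⟨j, hj.tail ⟨e, hpos, rfl, congrArg coord he'⟩⟩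

/-- A path that uses `a` is cut off after its last use of `a`. -/
theorem posRel_or_of_supportRel {f : Arc L T → ℝ} (a : Arc L T) {p q : ℕ × ℕ}
    (h : ReflTransGen (supportRel f) p q) :
    ReflTransGen (posRel f a) p q ∨ ReflTransGen (posRel f a) (coord a.head) q := by
  induction h with
  | refl => exact Or.inl .refl
  | tail _ h ih =>
    obtain ⟨e, h1, rfl, rfl⟩ := h
    by_cases he : e = a
    · subst he; exact Or.inr .refl
    · exact ih.imp (fun h => h.tail ⟨e, he, h1, rfl, rfl⟩) fun h => h.tail ⟨e, he, h1, rfl, rfl⟩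

/-- The supplies, listed row by row. -/
noncomputable def supplyEntry (I : MFG L T) (k : ℕ) : ℝ :=
  if h : k < L * T then (I.b (finProdFinEquiv.symm ⟨k, h⟩) : ℝ) else 0

theorem supplyEntry_eq (I : MFG L T) (v : Vertex L T) :
    I.supplyEntry (T * v.1 + v.2) = I.b v := by
  have h := (finProdFinEquiv v).2
  have e : ((finProdFinEquiv v : Fin (L * T)) : ℕ) = T * v.1 + v.2 := by
    rw [finProdFinEquiv_apply_val, add_comm]
  have e' : (⟨(finProdFinEquiv v).1, h⟩ : Fin (L * T)) = finProdFinEquiv v := rfl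
  rw [← e, supplyEntry, dif_pos h, e', Equiv.symm_apply_apply]

theorem sum_supply_eq_sum_rows (I : MFG L T) (w : ℕ × ℕ → Prop) [DecidablePred w] :
    ∑ v : Vertex L T, (if w (coord v) then (I.b v : ℝ) else 0) =
      ∑ l ∈ Finset.range L, ∑ t ∈ Finset.range T,
        if w (l, t) then I.supplyEntry (T * l + t) else 0 := by
  rw [Fintype.sum_prod_type, Finset.sum_range]
  refine Finset.sum_congr rfl fun l _ => ?_
  rw [Finset.sum_range]
  refine Finset.sum_congr rfl fun t _ => ?_
  rw [I.supplyEntry_eq (l, t)]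
  rfl

/-- The values of which every extreme flow value is one, up to sign. -/
def IsRowSum (I : MFG L T) (r : ℕ) (x : ℝ) : Prop :=
  ∃ (y : ℝ) (z z' : ℕ → ℝ), IsIntervalSum (fun t => I.supplyEntry (T * r + t)) T y ∧
    (∀ l, IsIntervalSum (fun t => I.supplyEntry (T * l + t)) T (z l) ∧
      IsIntervalSum (fun t => I.supplyEntry (T * l + t)) T (z' l)) ∧
    x = y + ∑ l ∈ Finset.Ico (r + 1) L, (z l + z' l)

-- The value is the supply of the set from `exists_separating`, summed row by row. Rows before `r`
-- are not reached by flow and have no supply; the sign depends on which end of `a` the set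
-- contains.
open Classical in
theorem isRowSum_of_mem (I : MFG L T) (hU : I.IsUncapacitated) {r : ℕ} (hrL : r < L)
    (hr : ∀ v : Vertex L T, 0 < I.b v → (v.1 : ℕ) = r) (a : Arc L T) {x : ℝ}
    (hx : x ∈ I.extremeFlowValues a) : I.IsRowSum r x ∨ I.IsRowSum r (-x) := by
  obtain ⟨f, hf, rfl⟩ := hx
  obtain ⟨hfb, hf0⟩ := (I.mem_flowPolyhedron hU).1 hf.1
  simp only
  rcases (hf0 a).lt_or_eq with ha | ha
  swap
  · left
    exact ⟨0, fun _ => 0, fun _ => 0, Or.inl rfl, fun _ => ⟨Or.inl rfl, Or.inl rfl⟩, by simp [← ha]⟩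
  set A := posRel f a with hAdef
  have hA : IsGridRel A := isGridRel_of_arc fun p q ⟨e, _, _, h⟩ => ⟨e, h⟩
  have hE : IsGridRel (supportRel f) := isGridRel_of_arc fun p q ⟨e, _, h⟩ => ⟨e, h⟩
  -- The vertices reached from the source row along the whole support, `a` included.
  set Act : ℕ × ℕ → Prop := fun p => ∃ j, ReflTransGen (supportRel f) (r, j) p with hAct
  have hsupp : ∀ v, I.b v ≠ 0 → Act (coord v) := fun v hv => I.exists_reach hfb hf0 hr v (Or.inl hv)
  have htail : ∀ e : Arc L T, 0 < f e → Act (coord e.tail) := fun e he =>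
    I.exists_reach hfb hf0 hr _ (Or.inr ⟨e, rfl, he⟩)
  have hhead : ∀ e : Arc L T, 0 < f e → Act (coord e.head) := fun e he => by
    obtain ⟨j, hj⟩ := htail e he
    exact ⟨j, hj.tail ⟨e, he, rfl, rfl⟩⟩
  have hActrow : ∀ p, Act p → r ≤ p.1 := fun p ⟨j, hj⟩ => (hE.le hj).1
  obtain ⟨W, hW, huv, ⟨I0, hI0, hI0W⟩, hrows⟩ := hA.exists_separating (r := r)
    (u := coord a.tail) (v := coord a.head) (Act := Act)
    (fun p q ⟨e, _, he, h1, _⟩ => h1 ▸ hActrow _ (htail e he))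
    (fun p q ⟨e, _, he, h1, h2⟩ => ⟨h1 ▸ htail e he, h2 ▸ hhead e he⟩)
    (fun z ⟨j, hj⟩ => (posRel_or_of_supportRel a hj).imp (fun h => ⟨j, h⟩) id)
    (htail a ha) (I.not_eqvGen_of_extreme hU hf ha) (hActrow _ (hhead a ha))
  have hsum := I.sum_supply_eq hfb hf0 a hW
  have hrow : I.IsRowSum r (∑ v : Vertex L T, if coord v ∈ W then (I.b v : ℝ) else 0) := by
    have hrows' : ∀ l, ∃ J J' : Set ℕ, J.OrdConnected ∧ J'.OrdConnected ∧ Disjoint J J' ∧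
        ∀ t, Act (l, t) → ((l, t) ∈ W ↔ t ∈ J ∪ J') := by
      intro l
      obtain ⟨J, J', h1, h2, h3 | h3⟩ := hrows l
      · obtain ⟨K, K', h4, h5, h6, h7⟩ := exists_disjoint_union h1 h2
        exact ⟨K, K', h4, h5, h6, h7 ▸ h3⟩
      · obtain ⟨K, K', h4, h5, h6, h7⟩ := exists_disjoint_union_diff h1 h2
        exact ⟨K, K', h4, h5, h6, h7 ▸ h3⟩
    choose J J' hJ hJ' hdisj hJW using hrows'
    have hAct' : ∀ l < L, ∀ t < T, I.supplyEntry (T * l + t) ≠ 0 → Act (l, t) := by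
      intro l hl t ht h
      rw [I.supplyEntry_eq (⟨l, hl⟩, ⟨t, ht⟩)] at h
      exact hsupp (⟨l, hl⟩, ⟨t, ht⟩) (by exact_mod_cast h)
    refine ⟨_, _, _, isIntervalSum_of_ordConnected _ T hI0, fun l =>
      ⟨isIntervalSum_of_ordConnected _ T (hJ l), isIntervalSum_of_ordConnected _ T (hJ' l)⟩, ?_⟩
    rw [I.sum_supply_eq_sum_rows (· ∈ W), Finset.range_eq_Ico,
      ← Finset.sum_Ico_consecutive _ (Nat.zero_le r) hrL.le, Finset.sum_eq_zero, zero_add,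
      Finset.sum_eq_sum_Ico_succ_bot hrL]
    · congr 1
      · exact Finset.sum_congr rfl fun t _ => by simp only [hI0W]
      · refine Finset.sum_congr rfl fun l hl => ?_
        rw [← Finset.sum_add_distrib]
        refine Finset.sum_congr rfl fun t ht => ?_
        -- The intervals describe `W` only at active vertices. At all others the supply is zero, so
        -- they do not affect the sum.
        by_cases h0 : I.supplyEntry (T * l + t) = 0
        · simp [h0]
        · have h1 := hJW l t (hAct' l (Finset.mem_Ico.1 hl).2 t (Finset.mem_range.1 ht) h0)
          have h2 : t ∈ J l → t ∉ J' l := fun h => Set.disjoint_left.1 (hdisj l) h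
          rw [Set.mem_union] at h1
          simp only [h1]
          by_cases h3 : t ∈ J l <;> by_cases h4 : t ∈ J' l <;> simp_all
    · intro l hl
      refine Finset.sum_eq_zero fun t ht => ?_
      have hl' := (Finset.mem_Ico.1 hl).2
      have : I.supplyEntry (T * l + t) = 0 := by
        by_contra h0
        have := hActrow _ (hAct' l (hl'.trans hrL) t (by simpa using ht) h0)
        simp at this; omega
      simp [this]
  rw [hsum] at hrow
  by_cases h1 : coord a.tail ∈ W
  · have h2 : coord a.head ∉ W := fun h => huv (iff_of_true h1 h)
    left; simpa [h1, h2] using hrow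
  · have h2 : coord a.head ∈ W := by
      by_contra h; exact huv (iff_of_false h1 h)
    right; simpa [h1, h2] using hrow

/-- On a grid with one column, the flow over an arc is the supply above it. -/
theorem eq_sum_of_one_column (I : MFG L 1) (hU : I.IsUncapacitated) (a : Arc L 1) {x : ℝ}
    (hx : x ∈ I.extremeFlowValues a) :
    x = ∑ l ∈ Finset.range (a.tail.1 + 1), I.supplyEntry l := by
  obtain ⟨f, hf, rfl⟩ := hx
  obtain ⟨hfb, hf0⟩ := (I.mem_flowPolyhedron hU).1 hf.1
  have hstep : ∀ e : Arc L 1, (e.head.1 : ℕ) = e.tail.1 + 1 := fun e => by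
    rcases e.2 with h | h
    · exact h.1
    · have := h.2; omega
  -- In a single column, `a` is the only arc that leaves the rows down to its tail.
  have h := I.sum_supply_eq hfb hf0 a (W := {p | p.1 ≤ a.tail.1}) (by
    rintro p q ⟨e, he, _, rfl, rfl⟩
    have h1 : (e.tail.1 : ℕ) ≠ a.tail.1 := by
      intro h1
      refine he (Subtype.ext (Prod.ext ?_ ?_))
      · exact Prod.ext (Fin.ext h1) (Subsingleton.elim _ _)
      · refine Prod.ext (Fin.ext ?_) (Subsingleton.elim _ _)
        have := hstep e
        have := hstep a
        change (e.head.1 : ℕ) = a.head.1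
        omega
    have h2 := hstep e
    simp only [coord, Set.mem_ofPred_eq]
    omega)
  have h1 := hstep a
  simp only [coord, Set.mem_ofPred_eq, le_refl, if_true, h1] at h
  rw [if_neg (by omega), sub_zero, mul_one] at h
  simp only
  rw [← h]
  have h2 := I.sum_supply_eq_sum_rows fun p => p.1 ≤ a.tail.1
  simp only [coord] at h2
  have h3 := a.head.1.2
  refine Eq.trans (Finset.sum_congr rfl fun v _ => ?_) (h2.trans ?_)
  · by_cases h4 : (v.1 : ℕ) ≤ a.tail.1 <;> simp [h4]
  simp only [Finset.sum_range_one, one_mul, add_zero]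
  rw [← Finset.sum_filter]
  refine Finset.sum_congr ?_ fun _ _ => rfl
  ext l
  simp only [Finset.mem_range, Finset.mem_filter]
  omega

end MFG

end GridFlow

namespace GridFlow

/-! ### Reasoning about programs -/

/-- Started in `s`, the program `p` halts within `B` steps in a configuration satisfying `Q`. -/
def HaltsWith (p : Program) (s : State) (B : ℕ) (Q : State → Prop) : Prop :=
  ∃ s' n, Runs p s s' n ∧ n ≤ B ∧ Q s'

namespace HaltsWith

variable {p q : Program} {c : Cond} {s : State} {m n B B' : ℕ} {Q Q' R : State → Prop}

theorem instr {i : Instr} (h : Q (i.apply s)) : HaltsWith (.instr i) s 1 Q :=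
  ⟨_, 1, .instr i s, le_rfl, h⟩

theorem mono (h : HaltsWith p s B Q) (hB : B ≤ B') (hQ : ∀ s, Q s → Q' s) :
    HaltsWith p s B' Q' := by
  obtain ⟨s', n, h1, h2, h3⟩ := h
  exact ⟨s', n, h1, h2.trans hB, hQ _ h3⟩

theorem seq (h1 : HaltsWith p s m R) (h2 : ∀ s', R s' → HaltsWith q s' n Q) :
    HaltsWith (.seq p q) s (m + n) Q := by
  obtain ⟨s', k, h3, h4, h5⟩ := h1
  obtain ⟨s'', k', h6, h7, h8⟩ := h2 s' h5
  exact ⟨s'', _, .seq h3 h6, add_le_add h4 h7, h8⟩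

theorem cond (h1 : c.holds s → HaltsWith p s B Q) (h2 : ¬ c.holds s → HaltsWith q s B Q) :
    HaltsWith (.cond c p q) s (B + 1) Q := by
  by_cases h : c.holds s
  · obtain ⟨s', n, h3, h4, h5⟩ := h1 h
    exact ⟨s', _, .cond_true h h3, Nat.succ_le_succ h4, h5⟩
  · obtain ⟨s', n, h3, h4, h5⟩ := h2 h
    exact ⟨s', _, .cond_false h h3, Nat.succ_le_succ h4, h5⟩

/-- A loop that runs `N` times, with an invariant depending on the number of rounds made. -/
theorem loop (Inv : ℕ → State → Prop) (t : ℕ → ℕ) (N : ℕ)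
    (hbody : ∀ k < N, ∀ s, Inv k s → c.holds s ∧ HaltsWith p s (t k) (Inv (k + 1)))
    (hend : ∀ s, Inv N s → ¬ c.holds s) (h0 : Inv 0 s) :
    HaltsWith (.loop c p) s (∑ k ∈ Finset.range N, (t k + 1) + 1) (Inv N) := by
  have key : ∀ d k, k + d = N → ∀ s, Inv k s →
      HaltsWith (.loop c p) s (∑ k ∈ Finset.Ico k N, (t k + 1) + 1) (Inv N) := by
    intro d
    induction d with
    | zero =>
      rintro k rfl s hs
      exact ⟨s, 1, .loop_false (hend s hs), by simp, hs⟩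
    | succ d ih =>
      intro k hk s hs
      obtain ⟨h1, s', n, h2, h3, h4⟩ := hbody k (by omega) s hs
      obtain ⟨s'', n', h5, h6, h7⟩ := ih (k + 1) (by omega) s' h4
      refine ⟨s'', _, .loop_true h1 h2 h5, ?_, h7⟩
      rw [Finset.sum_eq_sum_Ico_succ_bot (by omega)]
      omega
  have := key N 0 (by omega) s h0
  rwa [← Finset.range_eq_Ico] at this

/-- A loop that runs `N` times, each round taking at most `b` steps. -/
theorem loop_const (Inv : ℕ → State → Prop) (b : ℕ) (N : ℕ)
    (hbody : ∀ k < N, ∀ s, Inv k s → c.holds s ∧ HaltsWith p s b (Inv (k + 1)))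
    (hend : ∀ s, Inv N s → ¬ c.holds s) (h0 : Inv 0 s) :
    HaltsWith (.loop c p) s (N * (b + 1) + 1) (Inv N) :=
  (loop Inv (fun _ => b) N hbody hend h0).mono (by simp) fun _ h => h

end HaltsWith

/-- A straight-line program. -/
def block : List Instr → Program
  | [] => .instr .skip
  | i :: l => .seq (.instr i) (block l)

theorem HaltsWith.block {l : List Instr} {s : State} {Q : State → Prop}
    (h : Q (l.foldl (fun s i => i.apply s) s)) : HaltsWith (block l) s (l.length + 1) Q := by
  induction l generalizing s with
  | nil => exact .instr h
  | cons i l ih =>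
    exact (HaltsWith.seq (R := fun s' => s' = i.apply s) (.instr rfl)
      fun s' hs => ih (hs ▸ h)).mono (by simp; omega) fun _ h => h

theorem Runs.length_out_le {p : Program} {s s' : State} {n : ℕ} (h : Runs p s s' n) :
    s'.out.length ≤ s.out.length + n := by
  induction h with
  | instr i s => cases i <;> simp [Instr.apply]
  | _ => omega

/-! ### The algorithm -/

/-- Appends, for every entry of the list in the real memory and every nonempty interval of the row
whose first address is in register `8`, the sum of the two. -/
def roundProg : Program :=
  .seq (block [.imove 14 13, .iconst 10 0])
    (.loop (.ilt 10 14)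
      (.seq (block [.iconst 11 0])
        (.seq
          (.loop (.ilt 11 1)
            (.seq (block [.rload 1 10, .iadd 12 8 11, .iadd 15 8 1])
              (.seq
                (.loop (.ilt 12 15)
                  (block [.read 2 12, .radd 1 1 2, .rstore 13 1, .iadd 13 13 6, .iadd 12 12 6]))
                (block [.iadd 11 11 6]))))
          (block [.iadd 10 10 6]))))

/-- Puts the first address of a row with a source into register `9`. -/
def scanProg : Program :=
  .loop (.ilt 8 7)
    (.seq (block [.iconst 11 0])
      (.seq
        (.loop (.ilt 11 1)
          (.seq (block [.iadd 15 8 11, .read 1 15])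
            (.seq (.cond (.rlt 0 1) (.instr (.imove 9 8)) (.instr .skip))
              (block [.iadd 11 11 6]))))
        (block [.iadd 8 8 1])))

/-- Outputs the entries of the list and their negatives. -/
def emitProg : Program :=
  .seq (block [.iconst 10 0])
    (.loop (.ilt 10 13) (block [.rload 1 10, .emit 1, .rsub 2 0 1, .emit 2, .iadd 10 10 6]))

/-- The rounds for the rows after the first one. -/
def rowsProg : Program :=
  .loop (.ilt 8 7) (.seq roundProg (.seq roundProg (block [.iadd 8 8 1])))

/-- The algorithm for grids with at least two columns. -/
def wideProg : Program :=
  .seq (block [.imul 7 0 1])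
    (.seq scanProg
      (.seq (block [.iconst 13 1, .imove 8 9])
        (.seq roundProg
          (.seq (block [.iadd 8 8 1])
            (.seq rowsProg emitProg)))))

/-- The algorithm for grids with one column. -/
def narrowProg : Program :=
  .seq (.loop (.ile 10 2) (block [.read 1 10, .radd 2 2 1, .iadd 10 10 6])) (.instr (.emit 2))

/-- The algorithm. -/
def flowProg : Program :=
  .seq (.instr (.iconst 6 1)) (.cond (.ilt 6 1) wideProg narrowProg)

/-- The registers that stay fixed. -/
structure Env (L T : ℕ) (inp : ℕ → ℝ) (s : State) : Prop where
  rows : s.ireg 0 = L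
  cols : s.ireg 1 = T
  one : s.ireg 6 = 1
  size : s.ireg 7 = L * T
  zero : s.rreg 0 = 0
  inp_eq : s.inp = inp
  out_eq : s.out = []

/-- `x` is an entry of the list in the real memory. -/
def Found (s : State) (x : ℝ) : Prop := ∃ m < s.ireg 13, s.rmem m = x

theorem Found.mono {s s' : State} {x : ℝ} (h : Found s x) (h1 : s.ireg 13 ≤ s'.ireg 13)
    (h2 : ∀ m < s.ireg 13, s'.rmem m = s.rmem m) : Found s' x := by
  obtain ⟨m, hm, rfl⟩ := h
  exact ⟨m, hm.trans_le h1, h2 m hm⟩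

/-! ### Correctness and running time of the algorithm -/

variable {L T : ℕ} {inp : ℕ → ℝ}

/-- Real register `1` carries the running sum for the fixed left end `i`. Each further right end
costs one addition, hence constantly many steps per appended entry. -/
theorem inner_spec {s : State} (hs : Env L T inp s) {b k i M M0 : ℕ} {x : ℝ} (hi : i < T)
    (h8 : s.ireg 8 = b) (h10 : s.ireg 10 = k) (h11 : s.ireg 11 = i) (h12 : s.ireg 12 = b + i)
    (h13 : s.ireg 13 = M) (h14 : s.ireg 14 = M0) (h15 : s.ireg 15 = b + T) (hx : s.rreg 1 = x) :
    HaltsWith (.loop (.ilt 12 15)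
        (block [.read 2 12, .radd 1 1 2, .rstore 13 1, .iadd 13 13 6, .iadd 12 12 6])) s (7 * T + 1)
      fun s' => Env L T inp s' ∧ s'.ireg 8 = b ∧ s'.ireg 10 = k ∧ s'.ireg 11 = i ∧
        s'.ireg 14 = M0 ∧ s'.ireg 13 = M + (T - i) ∧ (∀ m < M, s'.rmem m = s.rmem m) ∧
        ∀ j, i ≤ j → j < T → Found s' (x + ∑ t ∈ Finset.Ico i (j + 1), inp (b + t)) := by
  refine (HaltsWith.loop_const (fun d s' => Env L T inp s' ∧ s'.ireg 8 = b ∧ s'.ireg 10 = k ∧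
      s'.ireg 11 = i ∧ s'.ireg 12 = b + i + d ∧ s'.ireg 14 = M0 ∧ s'.ireg 15 = b + T ∧
      s'.ireg 13 = M + d ∧ s'.rreg 1 = x + ∑ t ∈ Finset.Ico i (i + d), inp (b + t) ∧
      (∀ m < M, s'.rmem m = s.rmem m) ∧
      ∀ j, i ≤ j → j < i + d → Found s' (x + ∑ t ∈ Finset.Ico i (j + 1), inp (b + t)))
    6 (T - i) ?_ ?_ ?_).mono ?_ ?_
  · rintro d hd s' ⟨e, a8, a10, a11, a12, a14, a15, a13, a1, am, af⟩
    refine ⟨by simp only [Cond.holds, a12, a15]; omega, HaltsWith.block ?_⟩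
    simp only [List.foldl, Instr.apply]
    have hsum : x + ∑ t ∈ Finset.Ico i (i + (d + 1)), inp (b + t) =
        x + ∑ t ∈ Finset.Ico i (i + d), inp (b + t) + inp (b + i + d) := by
      rw [← add_assoc i d 1, Finset.sum_Ico_succ_top (by omega)]
      ring_nf
    refine ⟨⟨?_, ?_, ?_, ?_, ?_, ?_, ?_⟩, ?_, ?_, ?_, ?_, ?_, ?_, ?_, ?_, ?_, ?_⟩
    · simp [e.rows]
    · simp [e.cols]
    · simp [e.one]
    · simp [e.size]
    · simp [e.zero]
    · simp [e.inp_eq]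
    · simp [e.out_eq]
    · simp [a8]
    · simp [a10]
    · simp [a11]
    · simp [a12, e.one]; ring
    · simp [a14]
    · simp [a15]
    · simp [a13, e.one]; ring
    · simp [a1, a12, e.inp_eq, hsum]
    · intro m hm
      have : m ≠ M + d := by omega
      simp [a13, this, am m hm]
    · intro j hj hj'
      rcases Nat.lt_or_ge j (i + d) with h | h
      · refine (af j hj h).mono (by simp [a13, e.one]) fun m hm => ?_
        have : m ≠ M + d := by omega
        simp [a13, this]
      · obtain rfl : j = i + d := by omega
        refine ⟨M + d, by simp [a13, e.one], ?_⟩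
        simp [a13, a1, a12, e.inp_eq, add_assoc i d 1, hsum]
  · rintro s' ⟨e, a8, a10, a11, a12, a14, a15, a13, a1, am, af⟩
    simp only [Cond.holds, a12, a15]; omega
  · exact ⟨hs, h8, h10, h11, by simp [h12], h14, h15, by simp [h13], by simp [hx],
      fun _ _ => rfl, fun j h h' => by omega⟩
  · have : T - i ≤ T := Nat.sub_le _ _
    omega
  · rintro s' ⟨e, a8, a10, a11, a12, a14, a15, a13, a1, am, af⟩
    exact ⟨e, a8, a10, a11, a14, a13, am, fun j h h' => af j h (by omega)⟩

/-- The number of nonempty intervals. -/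
theorem sum_range_sub_le (hT : 2 ≤ T) (M : ℕ) :
    M + M * ∑ i ∈ Finset.range T, (T - i) ≤ M * T ^ 2 := by
  have h : ∀ n, 2 * ∑ i ∈ Finset.range n, (n - i) = n * (n + 1) := by
    intro n
    induction n with
    | zero => simp
    | succ n ih =>
      rw [Finset.sum_range_succ', mul_add]
      simp only [Nat.add_sub_add_right, ih]
      simp; ring
  -- This is 1 + T(T+1)/2 ≤ T², which fails for T = 1; the 1 stands for the empty interval.
  have h1 : 1 + ∑ i ∈ Finset.range T, (T - i) ≤ T ^ 2 := by
    have := h T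
    nlinarith
  calc M + M * ∑ i ∈ Finset.range T, (T - i) = M * (1 + ∑ i ∈ Finset.range T, (T - i)) := by ring
    _ ≤ _ := Nat.mul_le_mul_left _ h1

theorem kBody_spec {s : State} (hs : Env L T inp s) {b k M M0 : ℕ} (hk : k < M)
    (h8 : s.ireg 8 = b) (h10 : s.ireg 10 = k)
    (h13 : s.ireg 13 = M) (h14 : s.ireg 14 = M0) :
    HaltsWith (.seq (block [.iconst 11 0])
        (.seq
          (.loop (.ilt 11 1)
            (.seq (block [.rload 1 10, .iadd 12 8 11, .iadd 15 8 1])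
              (.seq
                (.loop (.ilt 12 15)
                  (block [.read 2 12, .radd 1 1 2, .rstore 13 1, .iadd 13 13 6, .iadd 12 12 6]))
                (block [.iadd 11 11 6]))))
          (block [.iadd 10 10 6]))) s (T * (7 * T + 8) + 5)
      fun s' => Env L T inp s' ∧ s'.ireg 8 = b ∧ s'.ireg 10 = k + 1 ∧
        s'.ireg 14 = M0 ∧ s'.ireg 13 = M + ∑ i ∈ Finset.range T, (T - i) ∧
        (∀ m < M, s'.rmem m = s.rmem m) ∧
        ∀ i j, i ≤ j → j < T →
          Found s' (s.rmem k + ∑ t ∈ Finset.Ico i (j + 1), inp (b + t)) := by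
  set Inv : ℕ → State → Prop := fun d s' => Env L T inp s' ∧ s'.ireg 8 = b ∧ s'.ireg 10 = k ∧
      s'.ireg 11 = d ∧ s'.ireg 14 = M0 ∧ s'.ireg 13 = M + ∑ i ∈ Finset.range d, (T - i) ∧
      (∀ m < M, s'.rmem m = s.rmem m) ∧
      ∀ i j, i < d → i ≤ j → j < T →
        Found s' (s.rmem k + ∑ t ∈ Finset.Ico i (j + 1), inp (b + t)) with hInv
  refine (HaltsWith.seq (R := Inv 0) (HaltsWith.block ?_) fun s1 h1 => HaltsWith.seq (R := Inv T)
    (n := 2) (HaltsWith.loop_const Inv (7 * T + 7) T ?_ ?_ h1) fun s2 h2 => ?_).mono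
    (B := 2 + (T * (7 * T + 7 + 1) + 1 + 2)) (le_of_eq (by ring)) fun _ h => h
  · obtain ⟨e1, e2, e3, e4, e5, e6, e7⟩ := hs
    simp only [List.foldl, Instr.apply, hInv]
    refine ⟨⟨by simpa, by simpa, by simpa, by simpa, by simpa, by simpa, by simpa⟩,
      by simpa, by simpa, by simp, by simpa, by simpa, by simp, by simp⟩
  · rintro d hd s' ⟨e, a8, a10, a11, a14, a13, am, af⟩
    refine ⟨by simp only [Cond.holds, a11, e.cols]; omega, ?_⟩
    refine (HaltsWith.seq (m := 4) (n := 7 * T + 1 + 2) (R := fun s1 => Env L T inp s1 ∧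
      s1.ireg 8 = b ∧ s1.ireg 10 = k ∧ s1.ireg 11 = d ∧ s1.ireg 12 = b + d ∧
      s1.ireg 13 = s'.ireg 13 ∧ s1.ireg 14 = M0 ∧ s1.ireg 15 = b + T ∧ s1.rreg 1 = s.rmem k ∧
      s1.rmem = s'.rmem)
      (HaltsWith.block ?_) ?_).mono (by omega) fun _ h => h
    · obtain ⟨e1, e2, e3, e4, e5, e6, e7⟩ := e
      simp only [List.foldl, Instr.apply]
      exact ⟨⟨by simpa, by simpa, by simpa, by simpa, by simpa, by simpa, by simpa⟩,
        by simpa, by simpa, by simpa, by simp [a8, a11], by simp, by simpa, by simp [a8, e2],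
        by simp [a10, am k hk], by simp⟩
    · rintro s1 ⟨e, b8, b10, b11, b12, b13, b14, b15, b1, bm⟩
      refine HaltsWith.seq (inner_spec e hd b8 b10 b11 b12 b13 b14 b15 b1) ?_
      rintro s2 ⟨⟨e1, e2, e3, e4, e5, e6, e7⟩, c8, c10, c11, c14, c13, cm, cf⟩
      refine HaltsWith.block ?_
      simp only [List.foldl, Instr.apply, hInv]
      refine ⟨⟨by simpa, by simpa, by simpa, by simpa, by simpa, by simpa, by simpa⟩,
        by simpa, by simpa, by simp [c11, e3], by simpa, ?_, ?_, ?_⟩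
      · simp [c13, a13, Finset.sum_range_succ, add_assoc]
      · intro m hm
        rw [cm m (by omega), bm, am m hm]
      · intro i j hi hij hj
        refine Found.mono (s := s2) ?_ (by simp) (by simp)
        rcases Nat.lt_succ_iff_lt_or_eq.1 hi with h | rfl
        · refine (af i j h hij hj).mono (by omega) fun m hm => ?_
          rw [cm m hm, bm]
        · exact cf j hij hj
  · rintro s' ⟨e, a8, a10, a11, a14, a13, am, af⟩
    simp only [Cond.holds, a11, e.cols]; omega
  · obtain ⟨⟨e1, e2, e3, e4, e5, e6, e7⟩, a8, a10, a11, a14, a13, am, af⟩ := h2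
    refine HaltsWith.block ?_
    simp only [List.foldl, Instr.apply]
    refine ⟨⟨by simpa, by simpa, by simpa, by simpa, by simpa, by simpa, by simpa⟩,
      by simpa, by simp [a10, e3], by simpa, by simpa, by simpa, fun i j hij hj => ?_⟩
    exact (af i j (by omega) hij hj).mono (by simp) (by simp)

/-- The old entries stay in the list and account for the empty interval. Register `14` freezes the
old length, so entries appended in this round are not extended again. -/
theorem round_spec (hT : 2 ≤ T) {s : State} (hs : Env L T inp s) {b M : ℕ}
    (h8 : s.ireg 8 = b) (hpos : 1 ≤ s.ireg 13) (hM : s.ireg 13 ≤ M) :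
    HaltsWith roundProg s (25 * (M * T ^ 2))
      fun s' => Env L T inp s' ∧ s'.ireg 8 = b ∧ 1 ≤ s'.ireg 13 ∧ s'.ireg 13 ≤ M * T ^ 2 ∧
        ∀ x y, Found s x → IsIntervalSum (fun t => inp (b + t)) T y → Found s' (x + y) := by
  obtain ⟨M1, h13⟩ : ∃ M1, s.ireg 13 = M1 := ⟨_, rfl⟩
  rw [h13] at hpos hM
  set g := ∑ i ∈ Finset.range T, (T - i) with hg
  set Inv : ℕ → State → Prop := fun d s' => Env L T inp s' ∧ s'.ireg 8 = b ∧ s'.ireg 10 = d ∧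
      s'.ireg 14 = M1 ∧ s'.ireg 13 = M1 + d * g ∧ (∀ m < M1, s'.rmem m = s.rmem m) ∧
      ∀ k i j, k < d → i ≤ j → j < T →
        Found s' (s.rmem k + ∑ t ∈ Finset.Ico i (j + 1), inp (b + t)) with hInv
  refine (HaltsWith.seq (m := 3) (R := Inv 0) (HaltsWith.block ?_) fun s1 h1 =>
    HaltsWith.loop_const Inv (T * (7 * T + 8) + 5) M1 ?_ ?_ h1).mono ?_ ?_
  · obtain ⟨e1, e2, e3, e4, e5, e6, e7⟩ := hs
    simp only [List.foldl, Instr.apply, hInv]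
    refine ⟨⟨by simpa, by simpa, by simpa, by simpa, by simpa, by simpa, by simpa⟩,
      by simpa, by simp, by simpa, by simpa, by simp, by simp⟩
  · rintro d hd s' ⟨e, a8, a10, a14, a13, am, af⟩
    refine ⟨by simp only [Cond.holds, a10, a14]; omega, ?_⟩
    refine (kBody_spec e (hd.trans_le (Nat.le_add_right M1 (d * g))) a8 a10 a13 a14).mono le_rfl ?_
    rintro s2 ⟨e, c8, c10, c14, c13, cm, cf⟩
    refine ⟨e, c8, c10, c14, by rw [c13]; ring, fun m hm => ?_, fun k i j hk hij hj => ?_⟩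
    · rw [cm m (by omega), am m hm]
    · rcases Nat.lt_succ_iff_lt_or_eq.1 hk with h | rfl
      · exact (af k i j h hij hj).mono (by omega) fun m hm => cm m (by omega)
      · rw [← am k hd]; exact cf i j hij hj
  · rintro s' ⟨e, a8, a10, a14, a13, am, af⟩
    simp only [Cond.holds, a10, a14]; omega
  · have h1 : T * (7 * T + 8) + 6 ≤ 13 * T ^ 2 := by nlinarith
    have h2 : M1 * (T * (7 * T + 8) + 6) ≤ M * (13 * T ^ 2) := Nat.mul_le_mul hM h1
    have h3 : 1 ≤ M * T ^ 2 := Nat.mul_pos (by omega) (by positivity)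
    have h4 : M * (13 * T ^ 2) = 13 * (M * T ^ 2) := by ring
    simp only [add_assoc, Nat.reduceAdd] at h2 ⊢
    omega
  · rintro s' ⟨e, a8, a10, a14, a13, am, af⟩
    have h1 := sum_range_sub_le hT M1
    rw [← hg] at h1
    have h2 : M1 * T ^ 2 ≤ M * T ^ 2 := Nat.mul_le_mul_right _ hM
    refine ⟨e, a8, by omega, by omega, ?_⟩
    rintro x y ⟨m, hm, rfl⟩ (rfl | ⟨i, j, hij, hj, rfl⟩)
    · exact ⟨m, by omega, by rw [am m (by omega), add_zero]⟩
    · exact af m i j (by omega) hij hj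

/-- Each of the `L - 1 - r` later rows takes two rounds, one for each of its intervals, and so
multiplies the bound on the length by `T ^ 4`. -/
theorem rows_spec (hT : 2 ≤ T) {s : State} (hs : Env L T inp s) {r : ℕ} (hr : r < L)
    {Y : Set ℝ} (h8 : s.ireg 8 = T * (r + 1)) (hpos : 1 ≤ s.ireg 13) (hM : s.ireg 13 ≤ T ^ 2)
    (hY : ∀ y ∈ Y, Found s y) :
    HaltsWith rowsProg s (107 * T ^ (4 * (L - 1 - r) + 2))
      fun s' => Env L T inp s' ∧ 1 ≤ s'.ireg 13 ∧ s'.ireg 13 ≤ T ^ (4 * (L - 1 - r) + 2) ∧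
        ∀ y ∈ Y, ∀ z z' : ℕ → ℝ, (∀ l, IsIntervalSum (fun t => inp (T * l + t)) T (z l) ∧
          IsIntervalSum (fun t => inp (T * l + t)) T (z' l)) →
          Found s' (y + ∑ l ∈ Finset.Ico (r + 1) L, (z l + z' l)) := by
  refine (HaltsWith.loop (fun k s' => Env L T inp s' ∧ s'.ireg 8 = T * (r + 1 + k) ∧
    1 ≤ s'.ireg 13 ∧ s'.ireg 13 ≤ T ^ (4 * k + 2) ∧
        ∀ y ∈ Y, ∀ z z' : ℕ → ℝ, (∀ l, IsIntervalSum (fun t => inp (T * l + t)) T (z l) ∧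
          IsIntervalSum (fun t => inp (T * l + t)) T (z' l)) →
          Found s' (y + ∑ l ∈ Finset.Ico (r + 1) (r + 1 + k), (z l + z' l)))
    (fun k => 52 * T ^ (4 * k + 6)) (L - 1 - r) ?_ ?_ ?_).mono ?_ ?_
  · rintro k hk s' ⟨e, a8, a1, aM, af⟩
    refine ⟨?_, ?_⟩
    · simp only [Cond.holds, a8, e.size]
      rw [mul_comm L]
      exact Nat.mul_lt_mul_of_pos_left (by omega) (by omega)
    refine (HaltsWith.seq (round_spec hT e a8 a1 aM) fun s1 ⟨e1, b8, b1, bM, bf⟩ =>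
      HaltsWith.seq (n := 2) (round_spec hT e1 b8 b1 bM) fun s2 ⟨e2, c8, c1, cM, cf⟩ =>
      HaltsWith.block ?_).mono ?_ fun _ h => h
    · obtain ⟨e1, e2, e3, e4, e5, e6, e7⟩ := e2
      simp only [List.foldl, Instr.apply]
      refine ⟨⟨by simpa, by simpa, by simpa, by simpa, by simpa, by simpa, by simpa⟩,
        by simp [c8, e2]; ring, by simpa, ?_, fun y hy z z' hz => ?_⟩
      · have : T ^ (4 * (k + 1) + 2) = T ^ (4 * k + 2) * T ^ 2 * T ^ 2 := by ring
        simpa [this] using cM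
      · rw [← add_assoc (r + 1) k 1, Finset.sum_Ico_succ_top (by omega), ← add_assoc,
          ← add_assoc]
        exact (cf _ _ (bf _ _ (af y hy z z' hz) (hz _).1) (hz _).2).mono (by simp) (by simp)
    · have h1 : T ^ (4 * k + 2) * T ^ 2 ≤ T ^ (4 * k + 6) := by
        rw [← pow_add]; exact Nat.pow_le_pow_right (by omega) (by omega)
      have h2 : T ^ (4 * k + 2) * T ^ 2 * T ^ 2 = T ^ (4 * k + 6) := by ring
      have h3 : 0 < T ^ (4 * k + 6) := by positivity
      omega
  · rintro s' ⟨e, a8, a1, aM, af⟩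
    simp only [Cond.holds, a8, e.size]
    have : r + 1 + (L - 1 - r) = L := by omega
    rw [this, mul_comm L]
    exact lt_irrefl _
  · exact ⟨hs, h8, hpos, hM, fun y hy z z' _ => by simpa using hY y hy⟩
  · have key : ∀ N, ∑ k ∈ Finset.range N, (52 * T ^ (4 * k + 6) + 1) ≤ 106 * T ^ (4 * N + 2) := by
      intro N
      induction N with
      | zero => simp
      | succ N ih =>
        rw [Finset.sum_range_succ]
        have h1 : T ^ (4 * N + 6) = T ^ 4 * T ^ (4 * N + 2) := by ring
        have h2 : 16 ≤ T ^ 4 := by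
          calc 16 = 2 ^ 4 := by norm_num
            _ ≤ T ^ 4 := Nat.pow_le_pow_left hT 4
        have h3 : 16 * T ^ (4 * N + 2) ≤ T ^ (4 * N + 6) := h1 ▸ Nat.mul_le_mul_right _ h2
        have h4 : 0 < T ^ (4 * N + 6) := by positivity
        have h5 : 4 * (N + 1) + 2 = 4 * N + 6 := by ring
        rw [h5]
        omega
    have h1 := key (L - 1 - r)
    have h2 : 0 < T ^ (4 * (L - 1 - r) + 2) := by positivity
    omega
  · rintro s' ⟨e, a8, a1, aM, af⟩
    have : r + 1 + (L - 1 - r) = L := by omega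
    rw [this] at af
    exact ⟨e, a1, aM, af⟩

theorem emit_spec {s : State} (hs : Env L T inp s) {M : ℕ} (hM : s.ireg 13 ≤ M) :
    HaltsWith emitProg s (7 * M + 3) fun s' => ∀ x, Found s x → x ∈ s'.out ∧ -x ∈ s'.out := by
  set Inv : ℕ → State → Prop := fun d s' => s'.ireg 6 = 1 ∧ s'.rreg 0 = 0 ∧ s'.ireg 10 = d ∧
    s'.ireg 13 = s.ireg 13 ∧ s'.rmem = s.rmem ∧
    ∀ m < d, s.rmem m ∈ s'.out ∧ -s.rmem m ∈ s'.out with hInv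
  refine (HaltsWith.seq (m := 2) (R := Inv 0) (HaltsWith.block ?_) fun s1 h1 =>
    HaltsWith.loop_const Inv 6 (s.ireg 13) ?_ ?_ h1).mono (by omega) ?_
  · obtain ⟨e1, e2, e3, e4, e5, e6, e7⟩ := hs
    simp only [List.foldl, Instr.apply, hInv]
    exact ⟨by simpa, by simpa, by simp, by simp, by simp, by simp⟩
  · rintro d hd s' ⟨a6, a0, a10, a13, am, ao⟩
    refine ⟨by simp only [Cond.holds, a10, a13]; omega, HaltsWith.block ?_⟩
    simp only [List.foldl, Instr.apply, hInv]
    refine ⟨by simpa, by simpa, by simp [a10, a6], by simpa, by simpa, fun m hm => ?_⟩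
    rcases Nat.lt_succ_iff_lt_or_eq.1 hm with h | rfl
    · simp [ao m h]
    · simp [a10, am, a0]
  · rintro s' ⟨a6, a0, a10, a13, am, ao⟩
    simp only [Cond.holds, a10, a13]; omega
  · rintro s' ⟨a6, a0, a10, a13, am, ao⟩ x ⟨m, hm, rfl⟩
    exact ao m hm

/-- The row found need not be `r₀`: if there is no source, register `9` keeps the value `0` and row
`0` qualifies vacuously. -/
theorem scan_spec {s : State} (hT : 0 < T) (hL : 0 < L) (hs : Env L T inp s)
    (h8 : s.ireg 8 = 0) (h9 : s.ireg 9 = 0) {r₀ : ℕ}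
    (hr₀ : ∀ l < L, ∀ t < T, 0 < inp (T * l + t) → l = r₀) :
    HaltsWith scanProg s (L * (8 * T + 6) + 1)
      fun s' => Env L T inp s' ∧ s'.rmem = s.rmem ∧ ∃ r < L, s'.ireg 9 = T * r ∧
        ∀ l < L, ∀ t < T, 0 < inp (T * l + t) → l = r := by
  set P : ℕ → ℕ → State → Prop := fun l d s' => Env L T inp s' ∧ s'.rmem = s.rmem ∧
    s'.ireg 8 = T * l ∧ ∃ r < L, s'.ireg 9 = T * r ∧
      ∀ l' t, (l' < l ∧ t < T) ∨ (l' = l ∧ t < d) → 0 < inp (T * l' + t) → l' = r with hP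
  refine (HaltsWith.loop_const (fun l => P l 0) (8 * T + 5) L ?_ ?_ ?_).mono le_rfl ?_
  · intro l hl s' hs'
    refine ⟨?_, ?_⟩
    · obtain ⟨e, _, a8, _⟩ := hs'
      simp only [Cond.holds, a8, e.size]
      rw [mul_comm L]
      exact Nat.mul_lt_mul_of_pos_left hl hT
    refine (HaltsWith.seq (m := 2) (R := fun s1 => P l 0 s1 ∧ s1.ireg 11 = 0)
      (HaltsWith.block ?_) fun s1 h1 => HaltsWith.seq (n := 2)
        (HaltsWith.loop_const (fun d s2 => P l d s2 ∧ s2.ireg 11 = d) 7 T ?_ ?_ h1) ?_).mono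
        (by omega) fun _ h => h
    · obtain ⟨⟨e1, e2, e3, e4, e5, e6, e7⟩, am, a8, r, hr, a9, ap⟩ := hs'
      simp only [List.foldl, Instr.apply, hP]
      exact ⟨⟨⟨by simpa, by simpa, by simpa, by simpa, by simpa, by simpa, by simpa⟩,
        by simpa, by simpa, r, hr, by simpa, ap⟩, by simp⟩
    · rintro d hd s2 ⟨⟨⟨e1, e2, e3, e4, e5, e6, e7⟩, am, a8, r, hr, a9, ap⟩, a11⟩
      refine ⟨by simp only [Cond.holds, a11, e2]; omega, ?_⟩
      refine (HaltsWith.seq (m := 3) (n := 4) (R := fun s3 => P l d s3 ∧ s3.ireg 11 = d ∧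
        s3.rreg 1 = inp (T * l + d)) (HaltsWith.block ?_) fun s3 h3 =>
        HaltsWith.seq (m := 2) (n := 2) (R := fun s4 => P l (d + 1) s4 ∧ s4.ireg 11 = d)
          (HaltsWith.cond (fun h => .instr ?_) fun h => .instr ?_) fun s4 h4 =>
          HaltsWith.block ?_).mono le_rfl fun _ h => h
      · simp only [List.foldl, Instr.apply, hP]
        exact ⟨⟨⟨by simpa, by simpa, by simpa, by simpa, by simpa, by simpa, by simpa⟩,
          by simpa, by simpa, r, hr, by simpa, ap⟩, by simpa, by simp [a8, a11, e6]⟩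
      · obtain ⟨⟨⟨e1, e2, e3, e4, e5, e6, e7⟩, am, a8, r, hr, a9, ap⟩, a11, a1⟩ := h3
        simp only [Cond.holds, e5, a1] at h
        simp only [Instr.apply, hP]
        refine ⟨⟨⟨by simpa, by simpa, by simpa, by simpa, by simpa, by simpa, by simpa⟩,
          by simpa, by simpa, l, hl, by simpa, ?_⟩, by simpa⟩
        intro l' t h1 h2
        have h3 := hr₀ l hl d hd h
        have h4 : l' < L ∧ t < T := by omega
        rw [h3, hr₀ l' h4.1 t h4.2 h2]
      · obtain ⟨⟨⟨e1, e2, e3, e4, e5, e6, e7⟩, am, a8, r, hr, a9, ap⟩, a11, a1⟩ := h3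
        simp only [Cond.holds, e5, a1] at h
        simp only [Instr.apply, hP]
        refine ⟨⟨⟨by simpa, by simpa, by simpa, by simpa, by simpa, by simpa, by simpa⟩,
          by simpa, by simpa, r, hr, by simpa, ?_⟩, by simpa⟩
        intro l' t h1 h2
        refine ap l' t ?_ h2
        rcases h1 with h5 | ⟨rfl, h5⟩
        · exact Or.inl h5
        · rcases Nat.lt_succ_iff_lt_or_eq.1 h5 with h5 | rfl
          · exact Or.inr ⟨rfl, h5⟩
          · exact absurd h2 h
      · obtain ⟨⟨⟨e1, e2, e3, e4, e5, e6, e7⟩, am, a8, r, hr, a9, ap⟩, a11⟩ := h4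
        simp only [List.foldl, Instr.apply, hP]
        exact ⟨⟨⟨by simpa, by simpa, by simpa, by simpa, by simpa, by simpa, by simpa⟩,
          by simpa, by simpa, r, hr, by simpa, ap⟩, by simp [a11, e3]⟩
    · rintro s2 ⟨⟨e, _⟩, a11⟩
      simp only [Cond.holds, a11, e.cols]; omega
    · rintro s2 ⟨⟨⟨e1, e2, e3, e4, e5, e6, e7⟩, am, a8, r, hr, a9, ap⟩, a11⟩
      refine HaltsWith.block ?_
      simp only [List.foldl, Instr.apply, hP]
      refine ⟨⟨by simpa, by simpa, by simpa, by simpa, by simpa, by simpa, by simpa⟩,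
        by simpa, by simp [a8, e2]; ring, r, hr, by simpa, fun l' t h1 h2 => ap l' t ?_ h2⟩
      omega
  · rintro s' ⟨e, _, a8, _⟩
    simp only [Cond.holds, a8, e.size]
    rw [mul_comm L]
    exact lt_irrefl _
  · exact ⟨hs, rfl, by simp [h8], 0, hL, by simp [h9], fun l' t h => by omega⟩
  · rintro s' ⟨e, am, a8, r, hr, a9, ap⟩
    exact ⟨e, am, r, hr, a9, fun l hl t ht => ap l t (Or.inl ⟨hl, ht⟩)⟩

namespace MFG

theorem wide_spec (I : MFG L T) (hL : 0 < L) (hT : 2 ≤ T) {s : State} {r₀ : ℕ}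
    (hr₀ : ∀ v : Vertex L T, 0 < I.b v → (v.1 : ℕ) = r₀)
    (h0 : s.ireg 0 = L) (h1 : s.ireg 1 = T) (h6 : s.ireg 6 = 1) (h8 : s.ireg 8 = 0)
    (h9 : s.ireg 9 = 0) (hz : s.rreg 0 = 0) (hm : s.rmem 0 = 0) (hinp : s.inp = I.supplyEntry)
    (hout : s.out = []) :
    HaltsWith wideProg s (200 * T ^ (4 * L - 2)) fun s' =>
      ∃ r < L, (∀ v : Vertex L T, 0 < I.b v → (v.1 : ℕ) = r) ∧
        ∀ x, I.IsRowSum r x → x ∈ s'.out ∧ -x ∈ s'.out := by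
  -- Scanning all the supplies stays within the time bound.
  have hpow : L * T ≤ T ^ (4 * L - 2) := by
    obtain ⟨n, rfl⟩ : ∃ n, L = n + 1 := ⟨L - 1, by omega⟩
    have h2 : n + 1 ≤ T ^ n :=
      (Nat.succ_le_of_lt n.lt_two_pow_self).trans (Nat.pow_le_pow_left hT n)
    calc (n + 1) * T ≤ T ^ n * T := Nat.mul_le_mul_right _ h2
      _ = T ^ (n + 1) := (pow_succ T n).symm
      _ ≤ _ := Nat.pow_le_pow_right (by omega) (by omega)
  have hL' : L ≤ L * T := Nat.le_mul_of_pos_right L (by omega)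
  have hscan : L * (8 * T + 6) = 8 * (L * T) + 6 * L := by ring
  have hsq : T ^ 2 ≤ T ^ (4 * L - 2) := Nat.pow_le_pow_right (by omega) (by omega)
  have hpos : 1 ≤ T ^ (4 * L - 2) := Nat.pow_pos (by omega)
  have hentry : ∀ r, (∀ v : Vertex L T, 0 < I.b v → (v.1 : ℕ) = r) ↔
      ∀ l < L, ∀ t < T, 0 < I.supplyEntry (T * l + t) → l = r := by
    refine fun r => ⟨fun h l hl t ht h' => ?_, fun h v hv => ?_⟩
    · rw [I.supplyEntry_eq (⟨l, hl⟩, ⟨t, ht⟩)] at h'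
      exact h (⟨l, hl⟩, ⟨t, ht⟩) (by exact_mod_cast h')
    · exact h v.1 v.1.2 v.2 v.2.2 (by rw [I.supplyEntry_eq]; exact_mod_cast hv)
  refine (HaltsWith.seq (m := 2) (n := 198 * T ^ (4 * L - 2))
    (R := fun s1 => Env L T I.supplyEntry s1 ∧ s1.ireg 8 = 0 ∧
    s1.ireg 9 = 0 ∧ s1.rmem 0 = 0) (HaltsWith.block ?_) ?_).mono (by omega) fun _ h => h
  · simp only [List.foldl, Instr.apply]
    exact ⟨⟨by simpa, by simpa, by simpa, by simp [h0, h1], by simpa, by simpa, by simpa⟩,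
      by simpa, by simpa, by simpa⟩
  rintro s1 ⟨e1, a8, a9, am⟩
  refine (HaltsWith.seq (n := 181 * T ^ (4 * L - 2))
    (scan_spec (by omega) hL e1 a8 a9 ((hentry r₀).1 hr₀)) ?_).mono (by omega) fun _ h => h
  rintro s2 ⟨e2, bm, r, hr, b9, br⟩
  -- The worst case is `r = 0`, where the exponents agree.
  have hexp : T ^ (4 * (L - 1 - r) + 2) ≤ T ^ (4 * L - 2) :=
    Nat.pow_le_pow_right (by omega) (by omega)
  refine (HaltsWith.seq (m := 3) (n := 25 * (1 * T ^ 2) + (2 + (107 * T ^ (4 * (L - 1 - r) + 2) +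
    (7 * T ^ (4 * (L - 1 - r) + 2) + 3)))) (R := fun s3 => Env L T I.supplyEntry s3 ∧
    s3.ireg 8 = T * r ∧ s3.ireg 13 = 1 ∧ Found s3 0) (HaltsWith.block ?_) ?_).mono (by omega)
    fun _ h => h
  · obtain ⟨e1, e2, e3, e4, e5, e6, e7⟩ := e2
    simp only [List.foldl, Instr.apply]
    exact ⟨⟨by simpa, by simpa, by simpa, by simpa, by simpa, by simpa, by simpa⟩,
      by simpa, by simp, 0, by simp, by simp [bm, am]⟩
  rintro s3 ⟨e3, c8, c13, c0⟩
  refine HaltsWith.seq (round_spec hT e3 c8 c13.ge c13.le) ?_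
  rintro s4 ⟨e4, d8, d1, dM, df⟩
  refine HaltsWith.seq (m := 2) (R := fun s5 => Env L T I.supplyEntry s5 ∧
    s5.ireg 8 = T * (r + 1) ∧ 1 ≤ s5.ireg 13 ∧ s5.ireg 13 ≤ T ^ 2 ∧
    ∀ y ∈ {y | IsIntervalSum (fun t => I.supplyEntry (T * r + t)) T y}, Found s5 y)
    (HaltsWith.block ?_) ?_
  · obtain ⟨e1, e2, e3, e4, e5, e6, e7⟩ := e4
    simp only [List.foldl, Instr.apply]
    refine ⟨⟨by simpa, by simpa, by simpa, by simpa, by simpa, by simpa, by simpa⟩,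
      by simp [d8, e2]; ring, by simpa, by simpa using dM, fun y hy => ?_⟩
    have := df 0 y c0 hy
    rw [zero_add] at this
    exact this.mono (by simp) (by simp)
  rintro s5 ⟨e5, f8, f1, fM, ff⟩
  refine HaltsWith.seq (rows_spec hT e5 hr f8 f1 fM ff) ?_
  rintro s6 ⟨e6, g1, gM, gf⟩
  refine (emit_spec e6 gM).mono le_rfl fun s7 h7 => ⟨r, hr, (hentry r).2 br, ?_⟩
  rintro x ⟨y, z, z', hy, hzz, rfl⟩
  exact h7 _ (gf y hy z z' hzz)

end MFG

theorem narrow_spec {s : State} {ρ : ℕ} (h2 : s.ireg 2 = ρ) (h6 : s.ireg 6 = 1)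
    (h10 : s.ireg 10 = 0) (hr : s.rreg 2 = 0) (hinp : s.inp = inp) (hout : s.out = []) :
    HaltsWith narrowProg s ((ρ + 1) * 5 + 2)
      fun s' => s'.out = [∑ l ∈ Finset.range (ρ + 1), inp l] := by
  refine HaltsWith.seq (m := (ρ + 1) * 5 + 1) (n := 1)
    (HaltsWith.loop_const (fun d s' => s'.ireg 2 = ρ ∧ s'.ireg 6 = 1 ∧
    s'.ireg 10 = d ∧ s'.rreg 2 = ∑ l ∈ Finset.range d, inp l ∧ s'.inp = inp ∧ s'.out = [])
    4 (ρ + 1) ?_ ?_ ?_) ?_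
  · rintro d hd s' ⟨a2, a6, a10, ar, ai, ao⟩
    refine ⟨by simp only [Cond.holds, a10, a2]; omega, HaltsWith.block ?_⟩
    simp only [List.foldl, Instr.apply]
    exact ⟨by simpa, by simpa, by simp [a10, a6], by simp [ar, ai, a10, Finset.sum_range_succ],
      by simpa, by simpa⟩
  · rintro s' ⟨a2, a6, a10, ar, ai, ao⟩
    simp only [Cond.holds, a10, a2]; omega
  · exact ⟨h2, h6, h10, by simpa, hinp, hout⟩
  · rintro s' ⟨a2, a6, a10, ar, ai, ao⟩
    refine HaltsWith.instr ?_
    simp [Instr.apply, ar, ao]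

end GridFlow

/-! ### The main theorem -/

open GridFlow in
theorem mainTheorem3 :
    ∃ (C : ℕ) (p : GridFlow.Program),
      ∀ (L T : ℕ) (I : GridFlow.MFG L T), I.IsUncapacitated → I.SourcesInOneRow →
        ∀ a : GridFlow.Arc L T,
          ((I.extremeFlowValues a).Finite ∧
            (I.extremeFlowValues a).ncard ≤ C * T ^ (4 * L - 2)) ∧
          ∃ (s : GridFlow.State) (n : ℕ),
            GridFlow.Runs p (I.start a) s n ∧
            (∀ x ∈ I.extremeFlowValues a, x ∈ s.out) ∧
            (2 ≤ T → n ≤ C * T ^ (4 * L - 2)) ∧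
            (T = 1 → n ≤ C * L) := by
  -- Two steps beyond the 200 of `wide_spec`: setting register `6` and testing whether `T > 1`.
  refine ⟨202, flowProg, fun L T I hU ⟨r₀, hr₀⟩ a => ?_⟩
  have hL : 0 < L := a.tail.1.pos
  have hT : 0 < T := a.tail.2.pos
  have hr₀' : ∀ v : Vertex L T, 0 < I.b v → (v.1 : ℕ) = r₀ := fun v hv => by rw [hr₀ v hv]
  -- The output is no longer than the number of steps, so for `T ≠ 1` the time bound also bounds the
  -- number of values. For `T = 1` it would give only a bound linear in `L`, whence the extra claim
  -- on the length of the output.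
  suffices h : HaltsWith flowProg (I.start a) (if T = 1 then 9 * L else 202 * T ^ (4 * L - 2))
      fun s => (∀ x ∈ I.extremeFlowValues a, x ∈ s.out) ∧ (T = 1 → s.out.length ≤ 1) by
    obtain ⟨s, n, hrun, hn, hs, hs1⟩ := h
    have hsub : I.extremeFlowValues a ⊆ {x | x ∈ s.out} := hs
    have hcard : (I.extremeFlowValues a).ncard ≤ s.out.length := by
      classical
      have h1 : {x | x ∈ s.out} = (s.out.toFinset : Set ℝ) := by ext; simp
      rw [h1] at hsub
      refine (Set.ncard_le_ncard hsub (Finset.finite_toSet _)).trans ?_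
      rw [Set.ncard_coe_finset]
      exact s.out.toFinset_card_le
    have hlen := hrun.length_out_le
    have hpos : 1 ≤ T ^ (4 * L - 2) := Nat.pow_pos hT
    refine ⟨⟨(List.finite_toSet s.out).subset hsub, ?_⟩, s, n, hrun, hs, fun h2 => ?_, fun h1 => ?_⟩
    · by_cases h1 : T = 1
      · have := hs1 h1
        omega
      · rw [if_neg h1] at hn
        have : (I.start a).out.length = 0 := rfl
        omega
    · rwa [if_neg (by omega)] at hn
    · rw [if_pos h1] at hn
      omega
  have hinp : (I.start a).inp = I.supplyEntry := rfl
  refine (HaltsWith.seq (m := 1) (R := fun s => s = (Instr.iconst 6 1).apply (I.start a))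
    (n := if T = 1 then 7 * L + 1 else 200 * T ^ (4 * L - 2) + 1) (HaltsWith.instr rfl) ?_).mono
    ?_ fun _ h => h
  · rintro s rfl
    by_cases h1 : T = 1
    · subst h1
      refine (HaltsWith.cond (B := 7 * L) (fun h => ?_) fun _ => ?_).mono (by simp) fun _ h => h
      · simp [Cond.holds, Instr.apply, MFG.start] at h
      · refine (narrow_spec (inp := I.supplyEntry) (ρ := a.tail.1) ?_ ?_ ?_ ?_ ?_ ?_).mono ?_
          fun s hs => ?_
        · simp [Instr.apply, MFG.start]
        · simp [Instr.apply, MFG.start]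
        · simp [Instr.apply, MFG.start]
        · simp [Instr.apply, MFG.start]
        · simpa [Instr.apply] using hinp
        · simp [Instr.apply, MFG.start]
        · have := a.tail.1.2
          omega
        · rw [hs]
          exact ⟨fun x hx => by simp [I.eq_sum_of_one_column hU a hx], fun _ => by simp⟩
    · rw [if_neg h1]
      refine HaltsWith.cond (fun _ => ?_) fun h => ?_
      · refine (I.wide_spec hL (by omega) hr₀' ?_ ?_ ?_ ?_ ?_ ?_ ?_ ?_ ?_).mono le_rfl
          fun s ⟨r, hr, hsrc, hs⟩ => ⟨fun x hx => ?_, fun h => absurd h h1⟩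
        · simp [Instr.apply, MFG.start]
        · simp [Instr.apply, MFG.start]
        · simp [Instr.apply, MFG.start]
        · simp [Instr.apply, MFG.start]
        · simp [Instr.apply, MFG.start]
        · simp [Instr.apply, MFG.start]
        · simp [Instr.apply, MFG.start]
        · simpa [Instr.apply] using hinp
        · simp [Instr.apply, MFG.start]
        · rcases I.isRowSum_of_mem hU hr hsrc a hx with h | h
          · exact (hs _ h).1
          · simpa using (hs _ h).2
      · simp [Cond.holds, Instr.apply, MFG.start] at h
        omega
  · have hpos : 1 ≤ T ^ (4 * L - 2) := Nat.pow_pos hT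
    split_ifs <;> omega
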